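/- Let $\mathcal L$ be a twisted affine Lie superalgebra with nonzero odd part, i.e. of type $A(2k,2\ell-1)^{(2)}$, $A(2k-1,2\ell-1)^{(2)}$ (with $k\ge 1$, $(k,\ell)\neq(1,1)$), $A(2k,2\ell)^{(4)}$ or $D(k+1,\ell)^{(2)}$, where $k\ge 0$, $\ell\geq 1$: that is, $\mathcal L=\bigoplus_{j=0}^{n-1}({}^{[j]}\mathfrak g\otimes t^j\mathbb C[t^{\pm n}])\oplus\mathbb Cc\oplus\mathbb Cd$ is the affinization, twisted by the standard automorphism $\sigma$ of order $n$, of the complex basic classical simple Lie superalgebra $\mathfrak g$ of the corresponding type. Let $\mathcal H=(({}^{[0]}\mathfrak g\cap\mathfrak h)\otimes 1)\oplus\mathbb Cc\oplus\mathbb Cd$ be its standard Cartan subalgebra, $R\subset\mathcal H^*$ the root system, $(\cdot,\cdot)$ the form on $\mathcal H^*$ induced by the invariant form of $\mathcal L$, and $\delta\in\mathcal H^*$ the functional with $\delta(d)=1$ that vanishes on $c$ and ${}^{[0]}\mathfrak g\cap\mathfrak h$. Put $R_{re}^\times=\{\alpha\in R\mid(\alpha,\alpha)\ne0\}$, $R_{re}=R_{re}^\times\cup\{0\}$,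 $R_{im}=\{\alpha\in R\mid(\alpha,R)=0\}$ and $R_{ns}=\{0\}\cup(R\setminus(R_{re}\cup R_{im}))$. In terms of the standard functionals $\varepsilon_i$ $(1\le i\le k)$ and $\delta_j$ $(1\le j\le\ell)$ let $$\dot R=\begin{cases}\pm\{\varepsilon_i,\ \delta_j,\ \varepsilon_i\pm\varepsilon_r,\ \delta_j\pm\delta_s,\ \varepsilon_i\pm\delta_j\}&\text{for }A(2k,2\ell-1)^{(2)},\ A(2k,2\ell)^{(4)},\\ \pm\{\varepsilon_i\pm\varepsilon_r,\ \delta_j\pm\delta_s,\ \varepsilon_i\pm\delta_j\}&\text{for }A(2k-1,2\ell-1)^{(2)},\\ \pm\{\varepsilon_i,\ \delta_j,\ \varepsilon_i\pm\varepsilon_r\ (i\ne r),\ \delta_j\pm\delta_s,\ \varepsilon_i\pm\delta_j\}&\text{for }D(k+1,\ell)^{(2)},\end{cases}$$ so that $R\subset\dot R+\mathbb Z\delta$. For $\dot\gamma\in\dot R$ put $S_{\dot\gamma}=\{\tau\in\mathbb Z\delta\mid\dot\gamma+\tau\in R\}$; a nonzero $\dot\gamma\in\dot R$ is called real (resp.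 nonsingular) if $\dot\gamma+S_{\dot\gamma}\subset R_{re}$ (resp. $\dot\gamma+S_{\dot\gamma}\subset R_{ns}$). Let $M$ be a finite weight $\mathcal L$-module, i.e. $M=\bigoplus_{\mu\in\mathcal H^*}M^\mu$ with all weight spaces $M^\mu$ finite-dimensional, and let $\operatorname{supp}(M)=\{\mu\mid M^\mu\ne0\}$. Let $R^{in}$ (resp. $R^{ln}$) be the set of all $\alpha\in R_{re}^\times$ such that the nonzero elements of $\mathcal L^\alpha$ act injectively (resp. locally nilpotently) on $M$. Assume that $M$ has shadow: $R_{re}^\times=R^{in}\cup R^{ln}$, $R^{ln}=\mathfrak B_M\cap R_{re}^\times$ and $R^{in}=\mathfrak C_M\cap R_{re}^\times$, where $\mathfrak B_M$ is the set of $\alpha\in\operatorname{span}_{\mathbb Z}R$ such that $\{m\in\mathbb Z^{>0}\mid\lambda+m\alpha\in\operatorname{supp}(M)\}$ is finite for all $\lambda\in\operatorname{supp}(M)$, and $\mathfrak C_M=\{\alpha\in\operatorname{span}_{\mathbb Z}R\mid\alpha+\operatorname{supp}(M)\subset\operatorname{supp}(M)\}$. Let $\zeta:\operatorname{span}_{\mathbb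 R}\dot R\to\mathbb R$ be a linear functional such that for every nonzero real $\dot\gamma\in\dot R$ $$\zeta(\dot\gamma)>0\iff\bigl(\dot\gamma+S_{\dot\gamma}\subset R^{ln}\ \text{ and }\ -\dot\gamma+S_{-\dot\gamma}\subset R^{in}\bigr).$$ Suppose that there are a nonzero nonsingular $\dot\varepsilon\in\dot R$ with $\zeta(\dot\varepsilon)>0$, a weight $\lambda\in\operatorname{supp}(M)$ and integers $k_1,k_2,\dots$ such that $\lambda+4n\dot\varepsilon+k_n\delta\in\operatorname{supp}(M)$ for all integers $n>0$. Then the dimensions of the weight spaces of $M$ are unbounded: for every $N$ there is $\mu\in\mathcal H^*$ with $\dim M^\mu>N$. -/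

import Mathlib

noncomputable section

namespace TwistedAffine

/-! ### The four families of types -/

/-- The four families of twisted affine Lie superalgebras with nonzero odd part:
`evenOdd` is `A(2k, 2ℓ-1)^(2)`, `oddOdd` is `A(2k-1, 2ℓ-1)^(2)`, `evenEven` is `A(2k, 2ℓ)^(4)`
and `orth` is `D(k+1, ℓ)^(2)`. -/
inductive Family where
  | evenOdd
  | oddOdd
  | evenEven
  | orth

/-- A twisted affine type `X^(n)` together with a number `scale`: the invariant form `κ` on the
underlying finite-dimensional basic classical simple Lie superalgebra is only determined up to a
nonzero scalar, and it is taken to be `scale` times the supertrace form. -/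
structure AffineType where
  family : Family
  k : ℕ
  l : ℕ
  scale : ℂ

/-- The range of the parameters: `k ≥ 0`, `ℓ ≥ 1`; for `A(2k-1, 2ℓ-1)^(2)` moreover `k ≥ 1`
(for `k = 0` there is no odd part) and `(k, ℓ) ≠ (1, 1)`. The form `κ` is nonzero. -/
def AffineType.Admissible (T : AffineType) : Prop :=
  1 ≤ T.l ∧ T.scale ≠ 0 ∧
    match T.family with
    | .oddOdd => 1 ≤ T.k ∧ ¬ (T.k = 1 ∧ T.l = 1)
    | _ => True

/-- Dimension of the even part of the zero weight space of the natural module. -/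
def Family.evenZeros : Family → ℕ
  | .evenOdd => 1
  | .oddOdd => 0
  | .evenEven => 1
  | .orth => 2

/-- Dimension of the odd part of the zero weight space of the natural module. -/
def Family.oddZeros : Family → ℕ
  | .evenEven => 1
  | _ => 0

/-- A primitive `n`-th root of unity, where the order `n` of the automorphism `σ` is `4` in the
family `evenEven` and `2` otherwise. -/
def Family.root : Family → ℂ
  | .evenEven => Complex.I
  | _ => -1

/-! ### Matrices over the superspace `V` -/

/-- Index set of the basis of the natural module `V`: even vectors of weight `±ε_i`, odd vectors
of weight `±δ_j` (the sign is `+` for `true`), even vectors of weight `0`, odd vectors of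
weight `0`. So `V` has superdimension `(2k+1 | 2ℓ)`, `(2k | 2ℓ)`, `(2k+1 | 2ℓ+1)`, `(2k+2 | 2ℓ)`
in the four families. -/
abbrev Idx (T : AffineType) : Type :=
  (Fin T.k × Bool) ⊕ (Fin T.l × Bool) ⊕ Fin T.family.evenZeros ⊕ Fin T.family.oddZeros

/-- Parity of a basis vector. -/
def par {T : AffineType} : Idx T → ℕ
  | .inl _ => 0
  | .inr (.inl _) => 1
  | .inr (.inr (.inl _)) => 0
  | .inr (.inr (.inr _)) => 1

/-- The index `ā` of the basis vector that is paired with the basis vector with index `a`. -/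
def bar {T : AffineType} : Idx T → Idx T
  | .inl (i, s) => .inl (i, !s)
  | .inr (.inl (j, s)) => .inr (.inl (j, !s))
  | .inr (.inr (.inl z)) => .inr (.inr (.inl z.rev))
  | .inr (.inr (.inr z)) => .inr (.inr (.inr z))

/-- The value `B(v_a, v_ā) = ±1` of the even nondegenerate bilinear form `B` on `V` that pairs
`v_a` with `v_ā` only: `B` is symmetric on the even part of `V`, skew-symmetric on the span of the
odd vectors of nonzero weight, and `1` on the odd vector of weight zero (if there is one). -/
def pairing {T : AffineType} : Idx T → ℂ
  | .inr (.inl (_, false)) => -1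
  | _ => 1

/-- Exchange of the two vectors of weight zero (in the family `orth`; the identity otherwise). -/
def swap {T : AffineType} : Idx T → Idx T
  | .inr (.inr (.inl z)) => .inr (.inr (.inl z.rev))
  | a => a

/-- `𝔤𝔩(V)` as a vector space. -/
abbrev SMat (T : AffineType) : Type := Matrix (Idx T) (Idx T) ℂ

/-- The superbracket of `𝔤𝔩(V)`: the bilinear extension of
`[X, Y] = X Y - (-1)^{|X||Y|} Y X` for homogeneous `X`, `Y`
(the `(a, b)` entry of a matrix has parity `|a| + |b|`). -/
def glBracket (T : AffineType) : SMat T →ₗ[ℂ] SMat T →ₗ[ℂ] SMat T :=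
  LinearMap.mk₂ ℂ
    (fun X Y => Matrix.of fun a b => ∑ c,
      (X a c * Y c b - (-1) ^ ((par a + par c) * (par c + par b)) * (Y a c * X c b)))
    (by
      intro X X' Y; ext a b
      simp only [Matrix.of_apply, Matrix.add_apply, ← Finset.sum_add_distrib]
      exact Finset.sum_congr rfl fun c _ => by ring)
    (by
      intro r X Y; ext a b
      simp only [Matrix.of_apply, Matrix.smul_apply, smul_eq_mul, Finset.mul_sum]
      exact Finset.sum_congr rfl fun c _ => by ring)
    (by
      intro X Y Y'; ext a b
      simp only [Matrix.of_apply, Matrix.add_apply, ← Finset.sum_add_distrib]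
      exact Finset.sum_congr rfl fun c _ => by ring)
    (by
      intro r X Y; ext a b
      simp only [Matrix.of_apply, Matrix.smul_apply, smul_eq_mul, Finset.mul_sum]
      exact Finset.sum_congr rfl fun c _ => by ring)

theorem glBracket_apply (T : AffineType) (X Y : SMat T) (a b : Idx T) :
    glBracket T X Y a b = ∑ c,
      (X a c * Y c b - (-1) ^ ((par a + par c) * (par c + par b)) * (Y a c * X c b)) := rfl

/-- The supertrace. -/
def str (T : AffineType) : SMat T →ₗ[ℂ] ℂ where
  toFun X := ∑ a, (-1) ^ par a * X a a
  map_add' X Y := by simp [mul_add, Finset.sum_add_distrib]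
  map_smul' r X := by
    simp only [Matrix.smul_apply, smul_eq_mul, Finset.mul_sum, RingHom.id_apply]
    exact Finset.sum_congr rfl fun c _ => by ring

/-- The supertrace form `(X, Y) ↦ str(X Y)`. -/
def strForm (T : AffineType) : SMat T →ₗ[ℂ] SMat T →ₗ[ℂ] ℂ :=
  LinearMap.mk₂ ℂ (fun X Y => str T (X * Y))
    (by intro X X' Y; rw [add_mul, map_add])
    (by intro r X Y; rw [smul_mul_assoc, map_smul])
    (by intro X Y Y'; rw [mul_add, map_add])
    (by intro r X Y; rw [mul_smul_comm, map_smul])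

/-- The negative of the superadjoint with respect to the form `B`:
`B(X u, v) + (-1)^{|X||u|} B(u, negAdj(X) v) = 0`. It is an automorphism of the Lie superalgebra
`𝔤𝔩(V)`. -/
def negAdj (T : AffineType) : SMat T →ₗ[ℂ] SMat T where
  toFun X := Matrix.of fun a b =>
    -(pairing (bar a) * pairing (bar b) * (-1) ^ (par a * (par a + par b)) * X (bar b) (bar a))
  map_add' X Y := by ext a b; simp only [Matrix.of_apply, Matrix.add_apply]; ring
  map_smul' r X := by
    ext a b; simp only [Matrix.of_apply, Matrix.smul_apply, smul_eq_mul, RingHom.id_apply]; ring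

theorem negAdj_apply (T : AffineType) (X : SMat T) (a b : Idx T) :
    negAdj T X a b =
      -(pairing (bar a) * pairing (bar b) * (-1) ^ (par a * (par a + par b)) *
        X (bar b) (bar a)) := rfl

/-- Conjugation by the exchange of the two vectors of weight zero. -/
def swapConj (T : AffineType) : SMat T →ₗ[ℂ] SMat T where
  toFun X := X.submatrix swap swap
  map_add' _ _ := rfl
  map_smul' _ _ := rfl

/-- The automorphism of `𝔤𝔩(V)` that induces `σ`. -/
def glAut (T : AffineType) : SMat T →ₗ[ℂ] SMat T :=
  match T.family with
  | .orth => swapConj T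
  | _ => negAdj T

/-- The special linear Lie superalgebra `𝔰𝔩(V)` (supertrace zero) in the families of type `A`, and
the orthosymplectic Lie superalgebra `𝔬𝔰𝔭(V)` (`negAdj X = X`) in the family `orth`. -/
def matrixAlg (T : AffineType) : Submodule ℂ (SMat T) :=
  match T.family with
  | .orth => LinearMap.ker (negAdj T - LinearMap.id)
  | _ => LinearMap.ker (str T)

/-- The scalar matrices that lie in `matrixAlg T`. This is zero except for `𝔰𝔩(m|m)`. -/
def scalars (T : AffineType) : Submodule ℂ (matrixAlg T) :=
  (Submodule.span ℂ {(1 : SMat T)}).submoduleOf (matrixAlg T)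

/-! Facts on matrices that are needed to see that the constructions below are well defined. -/

section wellDefined

variable {T : AffineType}

theorem bar_bar (a : Idx T) : bar (bar a) = a := by
  rcases a with ⟨i, s⟩ | ⟨j, s⟩ | z | z <;> simp [bar]

theorem swap_swap (a : Idx T) : swap (swap a) = a := by
  rcases a with ⟨i, s⟩ | ⟨j, s⟩ | z | z <;> simp [swap]

theorem par_bar (a : Idx T) : par (bar a) = par a := by
  rcases a with ⟨i, s⟩ | ⟨j, s⟩ | z | z <;> rfl

theorem par_swap (a : Idx T) : par (swap a) = par a := by
  rcases a with ⟨i, s⟩ | ⟨j, s⟩ | z | z <;> rfl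

theorem pairing_sq (a : Idx T) : pairing a * pairing a = 1 := by
  rcases a with ⟨i, s⟩ | ⟨j, _ | _⟩ | z | z <;> simp [pairing]

theorem par_eq (a : Idx T) : par a = 0 ∨ par a = 1 := by
  rcases a with ⟨i, s⟩ | ⟨j, s⟩ | z | z <;> simp [par]

def barEquiv : Idx T ≃ Idx T := ⟨bar, bar, bar_bar, bar_bar⟩

def swapEquiv : Idx T ≃ Idx T := ⟨swap, swap, swap_swap, swap_swap⟩

theorem str_negAdj (X : SMat T) : str T (negAdj T X) = -str T X := by
  change ∑ a, _ = -∑ a, _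
  rw [← Equiv.sum_comp barEquiv (fun a => (-1 : ℂ) ^ par a * X a a), ← Finset.sum_neg_distrib]
  refine Finset.sum_congr rfl fun a _ => ?_
  change (-1) ^ par a * negAdj T X a a = -((-1) ^ par (bar a) * X (bar a) (bar a))
  rw [negAdj_apply, pairing_sq, par_bar]
  rcases par_eq a with h | h <;> rw [h] <;> norm_num

theorem str_glBracket (X Y : SMat T) : str T (glBracket T X Y) = 0 := by
  change ∑ a, (-1) ^ par a * glBracket T X Y a a = 0
  simp only [glBracket_apply, Finset.sum_sub_distrib, mul_sub, Finset.mul_sum]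
  rw [sub_eq_zero, Finset.sum_comm]
  refine Finset.sum_congr rfl fun a _ => Finset.sum_congr rfl fun b _ => ?_
  rcases par_eq a with h | h <;> rcases par_eq b with h' | h' <;> rw [h, h'] <;> ring

theorem negAdj_glBracket (X Y : SMat T) :
    negAdj T (glBracket T X Y) = glBracket T (negAdj T X) (negAdj T Y) := by
  ext a b
  rw [negAdj_apply, glBracket_apply, glBracket_apply, ← Equiv.sum_comp barEquiv,
    Finset.mul_sum, ← Finset.sum_neg_distrib]
  refine Finset.sum_congr rfl fun c _ => ?_
  change -(_ * (X (bar b) (bar c) * Y (bar c) (bar a) -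
    (-1) ^ ((par (bar b) + par (bar c)) * (par (bar c) + par (bar a))) *
      (Y (bar b) (bar c) * X (bar c) (bar a)))) = _
  simp only [negAdj_apply, par_bar]
  have hc := pairing_sq (bar c)
  generalize pairing (bar c) = w at hc
  generalize pairing (bar a) = u
  generalize pairing (bar b) = v
  rcases mul_self_eq_one_iff.mp hc with rfl | rfl <;> rcases par_eq a with h | h <;>
    rcases par_eq b with h' | h' <;> rcases par_eq c with h'' | h'' <;>
    rw [h, h', h''] <;> norm_num <;> ring

theorem swapConj_glBracket (X Y : SMat T) :
    swapConj T (glBracket T X Y) = glBracket T (swapConj T X) (swapConj T Y) := by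
  ext a b
  change glBracket T X Y (swap a) (swap b) = _
  rw [glBracket_apply, glBracket_apply, ← Equiv.sum_comp swapEquiv]
  refine Finset.sum_congr rfl fun c _ => ?_
  change X (swap a) (swap c) * Y (swap c) (swap b) -
    (-1) ^ ((par (swap a) + par (swap c)) * (par (swap c) + par (swap b))) *
      (Y (swap a) (swap c) * X (swap c) (swap b)) = _
  simp only [par_swap]
  rfl

theorem str_eq_zero (X : matrixAlg T) : str T X = 0 := by
  obtain ⟨X, hX⟩ := X
  obtain ⟨F, k, l, s⟩ := T
  cases F
  case orth =>
    have h : negAdj _ X = X := by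
      simpa [matrixAlg, sub_eq_zero] using hX
    have h2 := str_negAdj X
    rw [h] at h2
    exact self_eq_neg.mp h2
  all_goals exact LinearMap.mem_ker.mp hX

theorem glBracket_mem (X Y : matrixAlg T) : glBracket T X Y ∈ matrixAlg T := by
  obtain ⟨X, hX⟩ := X
  obtain ⟨Y, hY⟩ := Y
  obtain ⟨F, k, l, s⟩ := T
  cases F
  case orth =>
    simp only [matrixAlg, LinearMap.mem_ker, LinearMap.sub_apply, LinearMap.id_apply,
      sub_eq_zero] at hX hY ⊢
    rw [negAdj_glBracket, hX, hY]
  all_goals exact LinearMap.mem_ker.mpr (str_glBracket X Y)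

theorem glAut_glBracket (X Y : SMat T) :
    glAut T (glBracket T X Y) = glBracket T (glAut T X) (glAut T Y) := by
  obtain ⟨F, k, l, s⟩ := T
  cases F
  case orth => exact swapConj_glBracket X Y
  all_goals exact negAdj_glBracket X Y

theorem negAdj_swapConj (X : SMat T) : negAdj T (swapConj T X) = swapConj T (negAdj T X) := by
  ext a b
  change negAdj T (swapConj T X) a b = negAdj T X (swap a) (swap b)
  rw [negAdj_apply, negAdj_apply]
  change -(_ * X (swap (bar b)) (swap (bar a))) = _
  rcases a with ⟨i, s⟩ | ⟨j, s⟩ | z | z <;> rcases b with ⟨i', s'⟩ | ⟨j', s'⟩ | z' | z' <;> rfl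

theorem glAut_mem (X : SMat T) (hX : X ∈ matrixAlg T) : glAut T X ∈ matrixAlg T := by
  obtain ⟨F, k, l, s⟩ := T
  cases F
  case orth =>
    simp only [matrixAlg, LinearMap.mem_ker, LinearMap.sub_apply, LinearMap.id_apply,
      sub_eq_zero] at hX ⊢
    change negAdj _ (swapConj _ X) = swapConj _ X
    rw [negAdj_swapConj, hX]
  all_goals
    refine LinearMap.mem_ker.mpr ((str_negAdj X).trans ?_)
    rw [LinearMap.mem_ker.mp hX, neg_zero]

theorem glBracket_one_left (Y : SMat T) : glBracket T 1 Y = 0 := by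
  ext a b
  rw [glBracket_apply, Finset.sum_sub_distrib]
  simp [Matrix.one_apply]

theorem glBracket_one_right (X : SMat T) : glBracket T X 1 = 0 := by
  ext a b
  rw [glBracket_apply, Finset.sum_sub_distrib]
  simp [Matrix.one_apply]

theorem glAut_one : glAut T 1 = 1 ∨ glAut T 1 = -1 := by
  obtain ⟨F, k, l, s⟩ := T
  cases F
  case orth =>
    left
    ext a b
    change (1 : SMat _) (swap a) (swap b) = _
    simp only [Matrix.one_apply]
    exact if_congr swapEquiv.apply_eq_iff_eq rfl rfl
  all_goals
    right
    ext a b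
    change negAdj _ 1 a b = _
    rw [negAdj_apply, Matrix.neg_apply, Matrix.one_apply, Matrix.one_apply]
    by_cases h : a = b
    · subst h
      rw [if_pos rfl, if_pos rfl, pairing_sq]
      rcases par_eq a with h | h <;> rw [h] <;> norm_num
    · have h2 : bar b ≠ bar a := fun h' => h (barEquiv.injective h').symm
      rw [if_neg h, if_neg h2]
      simp

theorem mem_scalars {X : matrixAlg T} (hX : X ∈ scalars T) : ∃ r : ℂ, (X : SMat T) = r • 1 := by
  obtain ⟨r, hr⟩ := Submodule.mem_span_singleton.mp (Submodule.mem_comap.mp hX)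
  exact ⟨r, hr.symm⟩

end wellDefined

/-! ### The finite-dimensional basic classical simple Lie superalgebra -/

/-- The superbracket of `matrixAlg T`. -/
def matBracket (T : AffineType) : matrixAlg T →ₗ[ℂ] matrixAlg T →ₗ[ℂ] matrixAlg T :=
  LinearMap.mk₂ ℂ (fun X Y => ⟨glBracket T X Y, glBracket_mem X Y⟩)
    (fun X X' Y => Subtype.ext (by simp)) (fun r X Y => Subtype.ext (by simp))
    (fun X Y Y' => Subtype.ext (by simp)) (fun r X Y => Subtype.ext (by simp))

/-- The finite-dimensional basic classical simple Lie superalgebra `𝔤` of type `X`: this is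
`𝔰𝔩(V)`, respectively `𝔰𝔩(V)` modulo scalar matrices if the even and the odd part of `V` have the
same dimension, in type `A`, and `𝔬𝔰𝔭(V)` in the family `orth`. -/
abbrev FinAlg (T : AffineType) : Type := matrixAlg T ⧸ scalars T

/-- The superbracket of `𝔤`. -/
def bracket (T : AffineType) : FinAlg T →ₗ[ℂ] FinAlg T →ₗ[ℂ] FinAlg T :=
  ((matBracket T).compr₂ (scalars T).mkQ).liftQ₂ (scalars T) (scalars T)
    (by
      intro X hX
      obtain ⟨r, hr⟩ := mem_scalars hX
      have h : ∀ Y, matBracket T X Y = 0 := fun Y => Subtype.ext (by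
        change glBracket T X Y = 0
        rw [hr, map_smul, LinearMap.smul_apply, glBracket_one_left, smul_zero])
      refine LinearMap.mem_ker.mpr (LinearMap.ext fun Y => ?_)
      simp [h])
    (by
      intro Y hY
      obtain ⟨r, hr⟩ := mem_scalars hY
      have h : ∀ X, matBracket T X Y = 0 := fun X => Subtype.ext (by
        change glBracket T X Y = 0
        rw [hr, map_smul, glBracket_one_right, smul_zero])
      refine LinearMap.mem_ker.mpr (LinearMap.ext fun X => ?_)
      simp [h])

/-- The form `κ` on `𝔤`, induced by `scale` times the supertrace form. -/
def kappa (T : AffineType) : FinAlg T →ₗ[ℂ] FinAlg T →ₗ[ℂ] ℂ :=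
  T.scale • ((strForm T).domRestrict₁₂ (matrixAlg T) (matrixAlg T)).liftQ₂ (scalars T) (scalars T)
    (by
      intro X hX
      obtain ⟨r, hr⟩ := mem_scalars hX
      refine LinearMap.mem_ker.mpr (LinearMap.ext fun Y => ?_)
      change str T ((X : SMat T) * Y) = 0
      rw [hr, smul_mul_assoc, one_mul, map_smul, str_eq_zero, smul_zero])
    (by
      intro Y hY
      obtain ⟨r, hr⟩ := mem_scalars hY
      refine LinearMap.mem_ker.mpr (LinearMap.ext fun X => ?_)
      change str T ((X : SMat T) * Y) = 0
      rw [hr, mul_smul_comm, mul_one, map_smul, str_eq_zero, smul_zero])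

/-- The automorphism `σ` of `𝔤`, of order `4` in the family `evenEven` and of order `2` otherwise. -/
def sigma (T : AffineType) : FinAlg T →ₗ[ℂ] FinAlg T :=
  (scalars T).mapQ (scalars T) ((glAut T).restrict glAut_mem) (by
    intro X hX
    obtain ⟨r, hr⟩ := mem_scalars hX
    refine Submodule.mem_comap.mpr (Submodule.mem_comap.mpr (Submodule.mem_span_singleton.mpr ?_))
    change ∃ a : ℂ, a • 1 = glAut T X
    rcases glAut_one (T := T) with h | h
    · exact ⟨r, by rw [hr, map_smul, h]⟩
    · exact ⟨-r, by rw [hr, map_smul, h, smul_neg, neg_smul]⟩)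

theorem sigma_bracket (T : AffineType) (x y : FinAlg T) :
    sigma T (bracket T x y) = bracket T (sigma T x) (sigma T y) := by
  obtain ⟨X, rfl⟩ := Submodule.Quotient.mk_surjective _ x
  obtain ⟨Y, rfl⟩ := Submodule.Quotient.mk_surjective _ y
  change Submodule.Quotient.mk _ = Submodule.Quotient.mk _
  congr 1
  exact Subtype.ext (glAut_glBracket (X : SMat T) Y)

/-- The homogeneous part `𝔤_i` of `𝔤` (`i = 0`: even, `i = 1`: odd). -/
def finPart (T : AffineType) (i : Fin 2) : Submodule ℂ (FinAlg T) :=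
  Submodule.map (scalars T).mkQ
    { carrier := {X | ∀ a b, (par a + par b) % 2 ≠ i.val → (X : SMat T) a b = 0}
      add_mem' := fun {X Y} hX hY a b h => by
        change (X : SMat T) a b + (Y : SMat T) a b = 0
        rw [hX a b h, hY a b h, add_zero]
      zero_mem' := fun _ _ _ => rfl
      smul_mem' := fun r X hX a b h => by
        change r • (X : SMat T) a b = 0
        rw [hX a b h, smul_zero] }

/-- The Cartan subalgebra `𝔥` of `𝔤`: the classes of the diagonal matrices. -/
def finCartan (T : AffineType) : Submodule ℂ (FinAlg T) :=
  Submodule.map (scalars T).mkQ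
    { carrier := {X | ∀ a b, a ≠ b → (X : SMat T) a b = 0}
      add_mem' := fun {X Y} hX hY a b h => by
        change (X : SMat T) a b + (Y : SMat T) a b = 0
        rw [hX a b h, hY a b h, add_zero]
      zero_mem' := fun _ _ _ => rfl
      smul_mem' := fun r X hX a b h => by
        change r • (X : SMat T) a b = 0
        rw [hX a b h, smul_zero] }

/-- Half the difference of the diagonal entries of a matrix at `a` and `ā`; this does not change
if a scalar matrix is added. If the diagonal matrix `X` is fixed by `σ`, then its entries at `a`
and `ā` are opposite, so that this is the eigenvalue of `X` on the basis vector `v_a`. -/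
def diagCoord (T : AffineType) (a : Idx T) : FinAlg T →ₗ[ℂ] ℂ :=
  (scalars T).liftQ
    { toFun := fun X => ((X : SMat T) a a - (X : SMat T) (bar a) (bar a)) / 2
      map_add' := fun X Y => by
        change ((X : SMat T) a a + (Y : SMat T) a a -
          ((X : SMat T) (bar a) (bar a) + (Y : SMat T) (bar a) (bar a))) / 2 = _
        ring
      map_smul' := fun r X => by
        change (r * (X : SMat T) a a - r * (X : SMat T) (bar a) (bar a)) / 2 =
          r * (((X : SMat T) a a - (X : SMat T) (bar a) (bar a)) / 2)
        ring }
    (by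
      intro X hX
      obtain ⟨r, hr⟩ := mem_scalars hX
      refine LinearMap.mem_ker.mpr ?_
      change ((X : SMat T) a a - (X : SMat T) (bar a) (bar a)) / 2 = 0
      simp [hr])

/-! ### The twisted affine Lie superalgebra -/

/-- `𝔤 ⊗ ℂ[t, t⁻¹] ⊕ ℂ c ⊕ ℂ d`: the triple `(f, r, s)` stands for `∑_p f(p) ⊗ t^p + r c + s d`. -/
abbrev Ambient (T : AffineType) : Type := (ℤ →₀ FinAlg T) × ℂ × ℂ

/-- The derivation `x ⊗ t^p ↦ p x ⊗ t^p`. -/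
def degDer (T : AffineType) (f : ℤ →₀ FinAlg T) : ℤ →₀ FinAlg T :=
  f.sum fun p x => Finsupp.single p ((p : ℂ) • x)

/-- The bracket
`[x ⊗ t^p + r c + s d, y ⊗ t^q + r' c + s' d]
  = [x, y] ⊗ t^(p+q) + p κ(x, y) δ_{p+q,0} c + s q y ⊗ t^q - s' p x ⊗ t^p`. -/
def ambBracket (T : AffineType) (u v : Ambient T) : Ambient T :=
  ((u.1.sum fun p x => v.1.sum fun q y => Finsupp.single (p + q) (bracket T x y)) +
      u.2.2 • degDer T v.1 - v.2.2 • degDer T u.1,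
    u.1.sum fun p x => v.1.sum fun q y => if p + q = 0 then (p : ℂ) * kappa T x y else 0,
    0)

/-- The form `(x ⊗ t^p + r c + s d, y ⊗ t^q + r' c + s' d) = κ(x, y) δ_{p+q,0} + r s' + s r'`. -/
def ambForm (T : AffineType) (u v : Ambient T) : ℂ :=
  (u.1.sum fun p x => v.1.sum fun q y => if p + q = 0 then kappa T x y else 0) +
    u.2.1 * v.2.2 + u.2.2 * v.2.1

theorem root_ne_zero (F : Family) : F.root ≠ 0 := by
  cases F <;> simp [Family.root]

/-- The twisted affine Lie superalgebra
`𝓛 = ⨁_j (^[j]𝔤 ⊗ t^j ℂ[t^n, t^(-n)]) ⊕ ℂ c ⊕ ℂ d`, where `^[j]𝔤` is the eigenspace of `σ` for the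
`j`-th power of the chosen primitive `n`-th root of unity. -/
def affineSubmodule (T : AffineType) : Submodule ℂ (Ambient T) where
  carrier := {u | ∀ p : ℤ, sigma T (u.1 p) = T.family.root ^ p • u.1 p}
  add_mem' {u v} hu hv p := by
    change sigma T (u.1 p + v.1 p) = _ • (u.1 p + v.1 p)
    rw [map_add, hu p, hv p, smul_add]
  zero_mem' p := by
    change sigma T 0 = _ • 0
    rw [map_zero, smul_zero]
  smul_mem' r u hu p := by
    change sigma T (r • u.1 p) = _ • (r • u.1 p)
    rw [map_smul, hu p, smul_comm]

/-- The twisted affine Lie superalgebra as a type. -/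
abbrev Alg (T : AffineType) : Type := affineSubmodule T

theorem degDer_apply (T : AffineType) (f : ℤ →₀ FinAlg T) (p : ℤ) :
    degDer T f p = (p : ℂ) • f p := by
  classical
  unfold degDer Finsupp.sum
  rw [Finsupp.finsetSum_apply, Finset.sum_eq_single p]
  · simp
  · intro q _ hq
    simp [hq]
  · intro hp
    simp [Finsupp.notMem_support_iff.mp hp]

theorem ambBracket_mem (T : AffineType) {u v : Ambient T} (hu : u ∈ affineSubmodule T)
    (hv : v ∈ affineSubmodule T) : ambBracket T u v ∈ affineSubmodule T := by
  classical
  intro m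
  have h1 : sigma T ((u.1.sum fun p x => v.1.sum fun q y =>
      Finsupp.single (p + q) (bracket T x y)) m) = T.family.root ^ m •
        (u.1.sum fun p x => v.1.sum fun q y => Finsupp.single (p + q) (bracket T x y)) m := by
    simp only [Finsupp.sum, Finsupp.finsetSum_apply, map_sum, Finset.smul_sum]
    refine Finset.sum_congr rfl fun p _ => Finset.sum_congr rfl fun q _ => ?_
    by_cases h : p + q = m
    · subst h
      simp only [Finsupp.single_eq_same]
      rw [sigma_bracket, hu p, hv q, zpow_add₀ (root_ne_zero _)]
      simp [smul_smul, mul_comm]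
    · simp [h]
  change sigma T (_ + u.2.2 • degDer T v.1 m - v.2.2 • degDer T u.1 m) =
    _ • (_ + u.2.2 • degDer T v.1 m - v.2.2 • degDer T u.1 m)
  rw [map_sub, map_add, h1, smul_sub, smul_add]
  simp only [map_smul, degDer_apply, hu m, hv m]
  congr 1
  · congr 1
    rw [smul_comm (T.family.root ^ m), smul_comm (T.family.root ^ m)]
  · rw [smul_comm (T.family.root ^ m), smul_comm (T.family.root ^ m)]

/-- The superbracket of `𝓛`. -/
def algBracket (T : AffineType) (u v : Alg T) : Alg T :=
  ⟨ambBracket T u v, ambBracket_mem T u.2 v.2⟩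

/-- The homogeneous part `𝓛_i` of `𝓛`; the elements `c` and `d` are even. -/
def algPart (T : AffineType) (i : Fin 2) : Set (Alg T) :=
  {u | (∀ p : ℤ, u.1.1 p ∈ finPart T i) ∧ (i = 1 → u.1.2 = 0)}

/-- The Cartan subalgebra `((^[0]𝔤 ∩ 𝔥) ⊗ 1) ⊕ ℂ c ⊕ ℂ d` of `𝓛`. -/
def cartan (T : AffineType) : Submodule ℂ (Alg T) where
  carrier := {u | u.1.1 0 ∈ finCartan T ∧ ∀ p : ℤ, p ≠ 0 → u.1.1 p = 0}
  add_mem' {u v} hu hv := by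
    refine ⟨add_mem hu.1 hv.1, fun p hp => ?_⟩
    change u.1.1 p + v.1.1 p = 0
    rw [hu.2 p hp, hv.2 p hp, add_zero]
  zero_mem' := ⟨zero_mem _, fun _ _ => rfl⟩
  smul_mem' r u hu := by
    refine ⟨Submodule.smul_mem _ r hu.1, fun p hp => ?_⟩
    change r • u.1.1 p = 0
    rw [hu.2 p hp, smul_zero]

/-- The dual space of the Cartan subalgebra. -/
abbrev Wt (T : AffineType) : Type := Module.Dual ℂ (cartan T)

/-- The functional `h ↦` (eigenvalue of the degree-zero part of `h` on the basis vector `v_a`). -/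
def wtOf (T : AffineType) (a : Idx T) : Wt T where
  toFun h := diagCoord T a (h.1.1.1 0)
  map_add' h h' := map_add (diagCoord T a) (h.1.1.1 0) (h'.1.1.1 0)
  map_smul' r h := map_smul (diagCoord T a) r (h.1.1.1 0)

/-- The functional `ε_i`. -/
def eps (T : AffineType) (i : Fin T.k) : Wt T := wtOf T (.inl (i, true))

/-- The functional `δ_j`. -/
def del (T : AffineType) (j : Fin T.l) : Wt T := wtOf T (.inr (.inl (j, true)))

/-- The functional `δ`: it is `1` on `d`, and `0` on `c` and on `^[0]𝔤 ∩ 𝔥`. It generates the group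
that is generated by the imaginary roots. -/
def delta (T : AffineType) : Wt T where
  toFun h := h.1.1.2.2
  map_add' _ _ := rfl
  map_smul' _ _ := rfl

/-! ### Roots -/

/-- The root space `𝓛^α`. -/
def rootSpace (T : AffineType) (α : Wt T) : Set (Alg T) :=
  {x | ∀ h : cartan T, algBracket T h x = α h • x}

/-- The root system `R` of `𝓛` with respect to the Cartan subalgebra. -/
def roots (T : AffineType) : Set (Wt T) :=
  {α | ∃ x ∈ rootSpace T α, x ≠ 0}

/-- The element `t_α` of the Cartan subalgebra with `(t_α, h) = α(h)` for all `h`. It exists and is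
unique, as the form is nondegenerate on the Cartan subalgebra. -/
def dualVec (T : AffineType) (α : Wt T) : cartan T :=
  Classical.epsilon fun t : cartan T => ∀ h : cartan T, ambForm T t.1 h.1 = α h

/-- The form on the dual space of the Cartan subalgebra. -/
def wtForm (T : AffineType) (α β : Wt T) : ℂ :=
  ambForm T (dualVec T α).1 (dualVec T β).1

/-- Nonzero real roots `R_re^×`. -/
def realRoots (T : AffineType) : Set (Wt T) :=
  {α | α ∈ roots T ∧ wtForm T α α ≠ 0}

/-- Imaginary roots `R_im`. -/
def imagRoots (T : AffineType) : Set (Wt T) :=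
  {α | α ∈ roots T ∧ ∀ β ∈ roots T, wtForm T α β = 0}

/-- Nonsingular roots `R_ns`, including `0`. -/
def nonsingRoots (T : AffineType) : Set (Wt T) :=
  {0} ∪ (roots T \ (({0} ∪ realRoots T) ∪ imagRoots T))

/-- The set `Ṙ`, type by type. -/
def dotRoots (T : AffineType) : Set (Wt T) :=
  match T.family with
  | .oddOdd =>
      {γ | ∃ i r, γ = eps T i + eps T r ∨ γ = eps T i - eps T r ∨ γ = -eps T i - eps T r} ∪
      {γ | ∃ j s, γ = del T j + del T s ∨ γ = del T j - del T s ∨ γ = -del T j - del T s} ∪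
      {γ | ∃ i j, γ = eps T i + del T j ∨ γ = eps T i - del T j ∨
        γ = -eps T i + del T j ∨ γ = -eps T i - del T j}
  | .orth =>
      {γ | ∃ i, γ = eps T i ∨ γ = -eps T i} ∪ {γ | ∃ j, γ = del T j ∨ γ = -del T j} ∪
      {γ | ∃ i r, i ≠ r ∧
        (γ = eps T i + eps T r ∨ γ = eps T i - eps T r ∨ γ = -eps T i - eps T r)} ∪
      {γ | ∃ j s, γ = del T j + del T s ∨ γ = del T j - del T s ∨ γ = -del T j - del T s} ∪
      {γ | ∃ i j, γ = eps T i + del T j ∨ γ = eps T i - del T j ∨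
        γ = -eps T i + del T j ∨ γ = -eps T i - del T j}
  | _ =>
      {γ | ∃ i, γ = eps T i ∨ γ = -eps T i} ∪ {γ | ∃ j, γ = del T j ∨ γ = -del T j} ∪
      {γ | ∃ i r, γ = eps T i + eps T r ∨ γ = eps T i - eps T r ∨ γ = -eps T i - eps T r} ∪
      {γ | ∃ j s, γ = del T j + del T s ∨ γ = del T j - del T s ∨ γ = -del T j - del T s} ∪
      {γ | ∃ i j, γ = eps T i + del T j ∨ γ = eps T i - del T j ∨
        γ = -eps T i + del T j ∨ γ = -eps T i - del T j}

/-- The roots in `γ + ℤδ`, that is the set `γ + S_γ` with `S_γ = {σ ∈ ℤδ | γ + σ ∈ R}`. -/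
def rootLine (T : AffineType) (γ : Wt T) : Set (Wt T) :=
  {α | α ∈ roots T ∧ ∃ m : ℤ, α = γ + m • delta T}

/-- The nonzero real elements of `Ṙ`. -/
def dotReal (T : AffineType) : Set (Wt T) :=
  {γ | γ ∈ dotRoots T ∧ γ ≠ 0 ∧ rootLine T γ ⊆ {0} ∪ realRoots T}

/-- The nonzero nonsingular elements of `Ṙ`. -/
def dotNonsing (T : AffineType) : Set (Wt T) :=
  {γ | γ ∈ dotRoots T ∧ γ ≠ 0 ∧ rootLine T γ ⊆ nonsingRoots T}

/-! ### Modules -/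

section modules

variable {T : AffineType} {M : Type*} [AddCommGroup M] [Module ℂ M]

/-- `ρ` makes the vector space `M` a module over the Lie superalgebra `𝓛`:
`[x, y] v = x y v - (-1)^{|x||y|} y x v` for homogeneous `x`, `y`. -/
def IsRep (ρ : Alg T →ₗ[ℂ] Module.End ℂ M) : Prop :=
  ∀ (i j : Fin 2) (x y : Alg T), x ∈ algPart T i → y ∈ algPart T j →
    ρ (algBracket T x y) = ρ x * ρ y - (-1 : ℂ) ^ (i.val * j.val) • (ρ y * ρ x)

/-- The weight space `M^μ`. -/
def weightSpace (ρ : Alg T →ₗ[ℂ] Module.End ℂ M) (μ : Wt T) : Submodule ℂ M where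
  carrier := {v | ∀ h : cartan T, ρ h v = μ h • v}
  add_mem' {v w} hv hw h := by rw [map_add, hv h, hw h, smul_add]
  zero_mem' h := by rw [map_zero, smul_zero]
  smul_mem' r v hv h := by rw [map_smul, hv h, smul_comm]

/-- The support of `M`. -/
def support (ρ : Alg T →ₗ[ℂ] Module.End ℂ M) : Set (Wt T) :=
  {μ | weightSpace ρ μ ≠ ⊥}

open Classical in
/-- `M` is a finite weight module: the direct sum of its weight spaces, which are all
finite-dimensional. -/
def IsFiniteWeight (ρ : Alg T →ₗ[ℂ] Module.End ℂ M) : Prop :=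
  DirectSum.IsInternal (weightSpace ρ) ∧ ∀ μ, FiniteDimensional ℂ (weightSpace ρ μ)

/-- The set `R^in` of the nonzero real roots `α` such that the nonzero elements of `𝓛^α` act
injectively on `M`. -/
def injRoots (ρ : Alg T →ₗ[ℂ] Module.End ℂ M) : Set (Wt T) :=
  {α | α ∈ realRoots T ∧ ∀ x ∈ rootSpace T α, x ≠ 0 → Function.Injective (ρ x)}

/-- The set `R^ln` of the nonzero real roots `α` such that the nonzero elements of `𝓛^α` act
locally nilpotently on `M`. -/
def nilRoots (ρ : Alg T →ₗ[ℂ] Module.End ℂ M) : Set (Wt T) :=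
  {α | α ∈ realRoots T ∧ ∀ x ∈ rootSpace T α, x ≠ 0 → ∀ v, ∃ n : ℕ, (ρ x ^ n) v = 0}

/-- The set `𝔅_M`. -/
def setB (ρ : Alg T →ₗ[ℂ] Module.End ℂ M) : Set (Wt T) :=
  {α | α ∈ AddSubgroup.closure (roots T) ∧
    ∀ μ ∈ support ρ, {n : ℤ | 0 < n ∧ μ + n • α ∈ support ρ}.Finite}

/-- The set `ℭ_M`. -/
def setC (ρ : Alg T →ₗ[ℂ] Module.End ℂ M) : Set (Wt T) :=
  {α | α ∈ AddSubgroup.closure (roots T) ∧ ∀ μ ∈ support ρ, α + μ ∈ support ρ}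

/-- `M` has shadow. -/
def HasShadow (ρ : Alg T →ₗ[ℂ] Module.End ℂ M) : Prop :=
  realRoots T = injRoots ρ ∪ nilRoots ρ ∧
    nilRoots ρ = setB ρ ∩ realRoots T ∧ injRoots ρ = setC ρ ∩ realRoots T

end modules

end TwistedAffine

end

namespace TwistedAffine

/-! ### `𝔰𝔩₂`-triples acting on weight modules. -/

section modules

variable {T : AffineType} {M : Type*} [AddCommGroup M] [Module ℂ M]
  {ρ : Alg T →ₗ[ℂ] Module.End ℂ M}

/-! Write `w_u` for the weight of a basis vector of the natural module. A suitable multiple `r w_u`,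
with `r` equal to 1 or 2 (`rootMult`), is real in `Ṙ`, and some `r w_u + pδ` is a root carried by an
even `𝔰𝔩₂`-triple. Every nonzero element of `Ṙ` is `w_u`, `2 w_u`, or a sum `w_u + w_v` of
independent weights. As `r` divides 4, `4ε` is then a positive integral combination of one or two
such real elements, so `ζ` is positive on at least one of them. For a corresponding root `α`, the
defining property of `ζ` makes `α` locally nilpotent and every root on the opposite line injective.

The numbers `k_n` are harmless: the root strings are periodic modulo `4δ`, and adding a root `-α +
4zδ`, which is injective, preserves the support. One such step reduces `k_n` to a residue modulo 4,
and one residue occurs for arbitrarily large `n` (`exists_common_shift`).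

If only `α` is involved, the support now contains `μ + aα` for arbitrarily large `a`, which
contradicts `α ∈ 𝔅_M`; this case does not occur. Otherwise it contains `μ + aα + bβ` with `a`
unbounded, for a second root `β` chosen so that the root vectors `e`, `y` of `α`, `β` commute
(`exists_isRootPair_commuting`) and each coroot is orthogonal to the other root. If `-β` is
injective, or if both `±β` are nilpotent, the `β`-coordinate can be brought down to a bounded value
and the same contradiction arises (`unbounded_of_roots`).

There remains the case that `β` is injective (`unbounded_of_commuting`). Raising by `e` gives
vectors killed by `e` with arbitrarily large `α`-coordinate `x`. Powers of the injective `y`, which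
commutes with `e`, equalise their `β`-coordinates, and `f^x`, with `f` the injective root vector of
`-α`, carries them all into one weight space. There they are eigenvectors of `fe` whose eigenvalues
are quadratic in `x` and distinct for large `x`, hence they are linearly independent. Any number of
them can be taken. -/

theorem finCartan_le_finPart : finCartan T ≤ finPart T 0 := by
  refine Submodule.map_mono fun X hX a b hab => hX a b ?_
  rintro rfl
  exact hab (by simp [← two_mul])

theorem cartan_even (h : cartan T) : (h : Alg T) ∈ algPart T 0 := by
  refine ⟨fun p => ?_, fun h01 => absurd h01 (by decide)⟩
  by_cases hp : p = 0
  · subst hp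
    exact finCartan_le_finPart h.2.1
  · rw [h.2.2 p hp]
    exact zero_mem _

theorem IsRep.commutator (hρ : IsRep ρ) {x y : Alg T} (hx : x ∈ algPart T 0)
    (hy : y ∈ algPart T 0) (v : M) :
    ρ (algBracket T x y) v = ρ x (ρ y v) - ρ y (ρ x v) := by
  simp [hρ 0 0 x y hx hy]

theorem IsRep.map_mem_weightSpace (hρ : IsRep ρ) {x : Alg T} (hx : x ∈ algPart T 0) {α μ : Wt T}
    (hα : x ∈ rootSpace T α) {v : M} (hv : v ∈ weightSpace ρ μ) :
    ρ x v ∈ weightSpace ρ (μ + α) := by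
  intro h
  have h1 := hρ.commutator (cartan_even h) hx v
  rw [hα h, hv h, map_smul, LinearMap.smul_apply, map_smul] at h1
  rw [LinearMap.add_apply, add_smul, h1]
  abel

theorem IsRep.pow_mem_weightSpace (hρ : IsRep ρ) {x : Alg T} (hx : x ∈ algPart T 0) {α μ : Wt T}
    (hα : x ∈ rootSpace T α) {v : M} (hv : v ∈ weightSpace ρ μ) (n : ℕ) :
    (ρ x ^ n) v ∈ weightSpace ρ (μ + n • α) := by
  induction n with
  | zero => simpa using hv
  | succ n ih =>
    rw [pow_succ', Module.End.mul_apply, succ_nsmul, ← add_assoc]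
    exact hρ.map_mem_weightSpace hx hα ih

theorem mem_support {μ : Wt T} {v : M} (hv : v ∈ weightSpace ρ μ) (h0 : v ≠ 0) :
    μ ∈ support ρ :=
  fun h => h0 (by rw [h] at hv; exact hv)

theorem exists_of_mem_support {μ : Wt T} (h : μ ∈ support ρ) :
    ∃ v ∈ weightSpace ρ μ, v ≠ 0 :=
  Submodule.exists_mem_ne_zero_of_ne_bot h

/-- The commutation rule of `e` with a power of `f`, on a vector of weight `Λ` killed by `e`. The
operator `[e, f]` acts on the weight spaces through `h`. -/
theorem e_f_pow {e f : Module.End ℂ M} {α Λ : Wt T} {h : cartan T} {w : M} (hew : e w = 0)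
    (hfw : ∀ n : ℕ, (f ^ n) w ∈ weightSpace ρ (Λ - n • α))
    (hef : ∀ v, e (f v) - f (e v) = ρ h v) (n : ℕ) :
    e ((f ^ (n + 1)) w) = ((n + 1) * (Λ h - n / 2 * α h)) • (f ^ n) w := by
  induction n with
  | zero =>
    have h1 := hef w
    have h2 := hfw 0 h
    simp only [zero_smul, sub_zero, pow_zero, Module.End.one_apply] at h2
    rw [hew, map_zero, sub_zero, h2] at h1
    simpa using h1
  | succ n ih =>
    have h1 := hef ((f ^ (n + 1)) w)
    rw [ih, hfw (n + 1) h, map_smul] at h1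
    rw [pow_succ' f (n + 1), Module.End.mul_apply, sub_eq_iff_eq_add.mp h1,
      ← Module.End.mul_apply, ← pow_succ', ← add_smul]
    congr 1
    simp only [LinearMap.sub_apply, LinearMap.smul_apply, nsmul_eq_mul]
    push_cast
    ring

/-- An `𝔰𝔩₂`-triple up to normalisation: even root vectors for `α` and `-α` whose bracket is an
element of the Cartan subalgebra on which `α` does not vanish. -/
structure IsTriple (T : AffineType) (α : Wt T) (e f : Alg T) (h : cartan T) : Prop where
  e_mem : e ∈ rootSpace T α
  f_mem : f ∈ rootSpace T (-α)
  e_even : e ∈ algPart T 0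
  f_even : f ∈ algPart T 0
  e_ne : e ≠ 0
  f_ne : f ≠ 0
  bracket : algBracket T e f = h
  apply_ne : α h ≠ 0

/-- If both root vectors are locally nilpotent, then the string of weights through `μ` reaches
at least to the reflection of `μ`. -/
theorem sub_mem_support_of_nilpotent (hρ : IsRep ρ) {α : Wt T} {e f : Alg T} {h : cartan T}
    (t : IsTriple T α e f h) (he : ∀ v, ∃ n : ℕ, (ρ e ^ n) v = 0)
    {μ : Wt T} (hμ : μ ∈ support ρ) {j : ℕ} (hj : (j : ℝ) - 1 < (μ h / α h).re) :
    μ - j • α ∈ support ρ := by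
  classical
  obtain ⟨m, hm, hm0⟩ := exists_of_mem_support hμ
  have hfm : ∀ n, (ρ f ^ n) m ∈ weightSpace ρ (μ - n • α) := fun n => by
    simpa [sub_eq_add_neg] using hρ.pow_mem_weightSpace t.f_even t.f_mem hm n
  -- If `f^j m = 0`, the last nonzero vector `x = f^{j₀} m` is a lowest weight vector with `j₀ < j`.
  -- Local nilpotency of `e` makes the string above `x` finite, which forces `μ(h)/α(h) = j₀ - i/2 ≤
  -- j - 1`.
  refine mem_support (hfm j) fun hfj => ?_
  have hex : ∃ n, (ρ f ^ n) m = 0 := ⟨j, hfj⟩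
  have hpos : Nat.find hex ≠ 0 := fun h0 => hm0 (by simpa [h0] using Nat.find_spec hex)
  obtain ⟨j₀, hj₀⟩ := Nat.exists_eq_succ_of_ne_zero hpos
  have hx0 : (ρ f ^ j₀) m ≠ 0 := Nat.find_min hex (by omega)
  have hx1 : ρ f ((ρ f ^ j₀) m) = 0 := by
    rw [← Module.End.mul_apply, ← pow_succ', ← Nat.succ_eq_add_one, ← hj₀]
    exact Nat.find_spec hex
  have hj₀j : j₀ + 1 ≤ j := by
    have := Nat.find_min' hex hfj
    omega
  set x := (ρ f ^ j₀) m
  have hey : ∃ n, (ρ e ^ n) x = 0 := he x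
  have hpos' : Nat.find hey ≠ 0 := fun h0 => hx0 (by simpa [h0] using Nat.find_spec hey)
  obtain ⟨i, hi⟩ := Nat.exists_eq_succ_of_ne_zero hpos'
  have hy0 : (ρ e ^ i) x ≠ 0 := Nat.find_min hey (by omega)
  have hy1 : (ρ e ^ (i + 1)) x = 0 := by
    rw [← Nat.succ_eq_add_one, ← hi]
    exact Nat.find_spec hey
  -- The commutation rule with the roles of `e` and `f` exchanged, hence with `-α` and `-h`.
  have key := e_f_pow (ρ := ρ) (e := ρ f) (f := ρ e) (α := -α)
    (h := (-1 : ℂ) • h) (Λ := μ - j₀ • α) hx1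
    (fun n => by
      simpa [sub_eq_add_neg] using hρ.pow_mem_weightSpace t.e_even t.e_mem (hfm j₀) n)
    (fun v => by
      have := hρ.commutator t.e_even t.f_even v
      rw [t.bracket] at this
      rw [Submodule.coe_smul, map_smul, LinearMap.smul_apply, this]
      simp) i
  rw [hy1, map_zero, eq_comm, smul_eq_zero_iff_left hy0, mul_eq_zero] at key
  have hi1 : ((i : ℂ) + 1) ≠ 0 := by exact_mod_cast Nat.succ_ne_zero i
  have key' := key.resolve_left hi1
  simp only [map_smul, smul_eq_mul, LinearMap.sub_apply, LinearMap.neg_apply, LinearMap.smul_apply,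
    nsmul_eq_mul] at key'
  have hdiv : μ h / α h = ((j₀ - i / 2 : ℝ) : ℂ) := by
    rw [div_eq_iff t.apply_ne]
    push_cast
    linear_combination -key'
  rw [hdiv, Complex.ofReal_re] at hj
  have h1 : (j₀ : ℝ) + 1 ≤ j := by exact_mod_cast hj₀j
  have h2 : (0 : ℝ) ≤ i := Nat.cast_nonneg i
  linarith

theorem exists_highest (hρ : IsRep ρ) {α : Wt T} {e : Alg T} (he : e ∈ algPart T 0)
    (heα : e ∈ rootSpace T α) (hnil : ∀ v, ∃ n : ℕ, (ρ e ^ n) v = 0) {μ : Wt T}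
    (hμ : μ ∈ support ρ) :
    ∃ n : ℕ, ∃ w ∈ weightSpace ρ (μ + n • α), w ≠ 0 ∧ ρ e w = 0 := by
  classical
  obtain ⟨m, hm, hm0⟩ := exists_of_mem_support hμ
  have hex := hnil m
  have hpos : Nat.find hex ≠ 0 := fun h0 => hm0 (by simpa [h0] using Nat.find_spec hex)
  obtain ⟨j, hj⟩ := Nat.exists_eq_succ_of_ne_zero hpos
  refine ⟨j, (ρ e ^ j) m, hρ.pow_mem_weightSpace he heα hm j, Nat.find_min hex (by omega), ?_⟩
  rw [← Module.End.mul_apply, ← pow_succ', ← Nat.succ_eq_add_one, ← hj]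
  exact Nat.find_spec hex

theorem pow_ne_zero_of_injective {x : Module.End ℂ M} (hx : Function.Injective x) {v : M}
    (hv : v ≠ 0) (n : ℕ) : (x ^ n) v ≠ 0 := by
  rw [Module.End.pow_apply]
  exact fun h => hv (hx.iterate n (by simpa [← Module.End.pow_apply] using h))

/-- Weight multiplicities are unbounded if the root vector for `α` is locally nilpotent, the ones
for `-α` and `β` are injective, those for `α` and `β` commute, and the support contains weights
`μ + a α + b β` with `a` arbitrarily large. -/
theorem unbounded_of_commuting (hρ : IsRep ρ) (hfin : IsFiniteWeight ρ) {α β : Wt T}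
    {e f y : Alg T} {h : cartan T} (t : IsTriple T α e f h)
    (hnil : ∀ v, ∃ n : ℕ, (ρ e ^ n) v = 0) (hf : Function.Injective (ρ f))
    (hyβ : y ∈ rootSpace T β) (hy : y ∈ algPart T 0) (hyi : Function.Injective (ρ y))
    (hey : algBracket T e y = 0) (hβ : β h = 0) {μ : Wt T}
    (hsupp : ∀ C : ℕ, ∃ a b : ℕ, C ≤ a ∧ μ + a • α + b • β ∈ support ρ) (N : ℕ) :
    ∃ ν : Wt T, N < Module.finrank ℂ (weightSpace ρ ν) := by
  classical
  -- The `α`-coordinates of weight vectors killed by `e`. They are unbounded, because raising by `e`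
  -- only increases the coordinate.
  let X : Set ℕ := {x | ∃ b : ℕ, ∃ w ∈ weightSpace ρ (μ + x • α + b • β), w ≠ 0 ∧ ρ e w = 0}
  have hX : ∀ C : ℕ, ∃ x ∈ X, C ≤ x := fun C => by
    obtain ⟨a, b, ha, hab⟩ := hsupp C
    obtain ⟨n, w, hw, hw0, hew⟩ := exists_highest hρ t.e_even t.e_mem hnil hab
    refine ⟨a + n, ⟨b, w, ?_, hw0, hew⟩, by omega⟩
    have : μ + (a + n) • α + b • β = μ + a • α + b • β + n • α := by
      rw [add_smul]; abel
    rwa [this]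
  -- Two different `x`, `x'` with the same eigenvalue satisfy `2μ(h)/α(h) = -(x + x' + 1)`; beyond
  -- `C` this is impossible.
  obtain ⟨C, hC⟩ := exists_nat_gt ‖2 * μ h / α h‖
  have hinf : {x ∈ X | C ≤ x}.Infinite := by
    refine Set.infinite_of_not_bddAbove fun ⟨B, hB⟩ => ?_
    obtain ⟨x, hx, hx1⟩ := hX (max C (B + 1))
    have := hB ⟨hx, le_trans (le_max_left _ _) hx1⟩
    have := le_trans (le_max_right _ _) hx1
    omega
  obtain ⟨s, hs, hcard⟩ := hinf.exists_subset_card_eq (N + 1)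
  choose! b w hw hw0 hew using fun x (hx : x ∈ X) => hx
  -- The common `β`-coordinate: `y` can only raise, so the largest `b x` is taken.
  let Y := s.sup b
  let u : ℕ → M := fun x => (ρ f ^ x) ((ρ y ^ (Y - b x)) (w x))
  -- The eigenvalue of `fe` on `u x`: the factor of `e_f_pow` at `n = x - 1` for the weight `μ + Yβ
  -- + xα`. Since `β(h) = 0`, it does not depend on `Y`.
  let E : ℕ → ℂ := fun x => x * μ h + x * (x + 1) / 2 * α h
  have hcomm : ∀ v, ρ e (ρ y v) = ρ y (ρ e v) := fun v => by
    have := hρ.commutator t.e_even hy v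
    rwa [hey, map_zero, LinearMap.zero_apply, eq_comm, sub_eq_zero] at this
  have hcommp : ∀ (n : ℕ) v, ρ e v = 0 → ρ e ((ρ y ^ n) v) = 0 := fun n v hv => by
    induction n with
    | zero => simpa using hv
    | succ n ih => rw [pow_succ', Module.End.mul_apply, hcomm, ih, map_zero]
  have hyw : ∀ x ∈ s, (ρ y ^ (Y - b x)) (w x) ∈ weightSpace ρ (μ + Y • β + x • α) :=
    fun x hx => by
      have h1 := hρ.pow_mem_weightSpace hy hyβ (hw x (hs hx).1) (Y - b x)
      have h2 : b x ≤ Y := Finset.le_sup hx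
      have h3 : μ + Y • β + x • α = μ + x • α + b x • β + (Y - b x) • β := by
        conv_lhs => rw [← Nat.add_sub_cancel' h2, add_smul]
        abel
      rwa [h3]
  have hfy : ∀ x ∈ s, ∀ n : ℕ, (ρ f ^ n) ((ρ y ^ (Y - b x)) (w x)) ∈
      weightSpace ρ (μ + Y • β + x • α - n • α) := fun x hx n => by
    simpa [sub_eq_add_neg] using hρ.pow_mem_weightSpace t.f_even t.f_mem (hyw x hx) n
  have huw : ∀ x ∈ s, u x ∈ weightSpace ρ (μ + Y • β) := fun x hx => by
    simpa using hfy x hx x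
  have hu0 : ∀ x ∈ s, u x ≠ 0 := fun x hx =>
    pow_ne_zero_of_injective hf (pow_ne_zero_of_injective hyi (hw0 x (hs hx).1) _) _
  have hE : ∀ x ∈ s, (ρ f * ρ e) (u x) = E x • u x := fun x hx => by
    obtain _ | n := x
    · have : ρ e (u 0) = 0 := by
        simpa [u] using hcommp (Y - b 0) _ (hew 0 (hs hx).1)
      simp [this, E]
    · have := e_f_pow (ρ := ρ) (h := h) (hcommp (Y - b (n + 1)) _ (hew _ (hs hx).1)) (hfy _ hx)
        (fun v => by rw [← t.bracket, hρ.commutator t.e_even t.f_even]) n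
      rw [Module.End.mul_apply, this, map_smul, ← Module.End.mul_apply, ← pow_succ']
      congr 1
      simp only [LinearMap.add_apply, LinearMap.smul_apply, hβ, E, nsmul_eq_mul]
      push_cast
      ring
  have hEinj : ∀ x ∈ s, ∀ x' ∈ s, E x = E x' → x = x' := fun x hx x' hx' hxx' => by
    by_contra hne
    have hne' : (x : ℂ) - x' ≠ 0 := sub_ne_zero.mpr (by exact_mod_cast hne)
    have h1 : ((x : ℂ) - x') * (2 * μ h + (x + x' + 1) * α h) = 0 := by
      simp only [E] at hxx'
      linear_combination 2 * hxx'
    have h2 := (mul_eq_zero.mp h1).resolve_left hne'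
    have h3 : 2 * μ h / α h = -((x + x' + 1 : ℕ) : ℂ) := by
      rw [div_eq_iff t.apply_ne]
      push_cast
      linear_combination h2
    rw [h3, norm_neg, Complex.norm_natCast] at hC
    have h4 : x + x' + 1 < C := by exact_mod_cast hC
    have := (hs hx).2
    omega
  have hli : LinearIndependent ℂ (fun x : s => u x) :=
    Module.End.eigenvectors_linearIndependent' (ρ f * ρ e) (fun x : s => E x)
      (fun x x' hxx' => Subtype.ext (hEinj _ x.2 _ x'.2 hxx')) _
      (fun x => Module.End.hasEigenvector_iff.mpr
        ⟨Module.End.mem_eigenspace_iff.mpr (hE x x.2), hu0 x x.2⟩)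
  have hli' : LinearIndependent ℂ
      (fun x : s => (⟨u x, huw x x.2⟩ : weightSpace ρ (μ + Y • β))) :=
    LinearIndependent.of_comp (weightSpace ρ (μ + Y • β)).subtype hli
  -- Finite dimension is essential here: `finrank` is 0 on an infinite-dimensional space.
  have := hfin.2 (μ + Y • β)
  have hle := hli'.fintype_card_le_finrank
  rw [Fintype.card_coe, hcard] at hle
  exact ⟨_, hle⟩

/-! ### Moving weights within the support. -/

theorem false_of_mem_setB {α μ : Wt T} (hα : α ∈ setB ρ)
    (h : ∀ C : ℕ, ∃ a : ℕ, C ≤ a ∧ μ + a • α ∈ support ρ) : False := by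
  -- `μ` itself need not lie in the support, so the string is started at some `μ + aα` that does.
  obtain ⟨a, -, ha⟩ := h 0
  obtain ⟨B, hB⟩ := (hα.2 _ ha).bddAbove
  obtain ⟨b, hb, hb'⟩ := h (a + B.toNat + 1)
  have h1 : ((b : ℤ) - a) ∈ {n : ℤ | 0 < n ∧ μ + a • α + n • α ∈ support ρ} := by
    refine ⟨by omega, ?_⟩
    have : μ + a • α + ((b : ℤ) - a) • α = μ + b • α := by
      rw [sub_smul, natCast_zsmul, natCast_zsmul]; abel
    rwa [this]
  have := hB h1
  omega

theorem add_nsmul_mem_support {α μ : Wt T} (hα : α ∈ setC ρ) (hμ : μ ∈ support ρ) (n : ℕ) :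
    μ + n • α ∈ support ρ := by
  induction n with
  | zero => simpa using hμ
  | succ n ih =>
    have : μ + (n + 1) • α = α + (μ + n • α) := by rw [succ_nsmul]; abel
    rw [this]
    exact hα.2 _ ih

/-- Weights of the support with varying multiples of `δ` can be brought to a common one, modulo
lowering them by `α` once. -/
theorem exists_common_shift {α δ' lam : Wt T} (hα : ∀ z : ℤ, -α + (4 * z) • δ' ∈ setC ρ) {q : ℕ}
    (hq : 0 < q) {ν : ℕ → Wt T} {k : ℕ → ℤ}
    (h : ∀ n : ℕ, 0 < n → lam + (n * q) • α + ν n + k n • δ' ∈ support ρ) :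
    ∃ μ : Wt T, ∀ C : ℕ, ∃ n : ℕ, C ≤ n ∧ 0 < n ∧
      μ + (n * q - 1) • α + ν n ∈ support ρ := by
  have h1 : ∀ n : ℕ, 0 < n → lam + (k n % 4) • δ' + (n * q - 1) • α + ν n ∈ support ρ :=
    fun n hn => by
      -- One step along `-α - 4⌊k_n/4⌋δ` replaces `k_n` by its residue modulo 4 and costs one `α`.
      have h2 := (hα (-(k n / 4))).2 _ (h n hn)
      obtain ⟨j, hj⟩ := Nat.exists_eq_succ_of_ne_zero (Nat.mul_pos hn hq).ne'
      have h3 : lam + (k n % 4) • δ' + (n * q - 1) • α + ν n =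
          -α + (4 * -(k n / 4)) • δ' + (lam + (n * q) • α + ν n + k n • δ') := by
        rw [hj, Nat.succ_eq_add_one, Nat.add_sub_cancel, succ_nsmul]
        have h4 : k n % 4 = 4 * -(k n / 4) + k n := by omega
        rw [h4, add_smul]
        abel
      rwa [h3]
  by_contra! hcon
  choose C hC using hcon
  -- If none of the four candidates `lam + rδ'`, `r = 0, …, 3`, works, each has a bound beyond which
  -- it fails; this `n` exceeds all of them, yet its own residue gives a weight of the support.
  let n := C lam + C (lam + (1 : ℤ) • δ') + C (lam + (2 : ℤ) • δ') + C (lam + (3 : ℤ) • δ') + 1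
  have h5 := h1 n (by omega)
  have h6 : k n % 4 = 0 ∨ k n % 4 = 1 ∨ k n % 4 = 2 ∨ k n % 4 = 3 := by omega
  rcases h6 with h6 | h6 | h6 | h6 <;> rw [h6] at h5
  · rw [zero_smul, add_zero] at h5
    exact hC lam n (by omega) (by omega) h5
  all_goals exact hC _ n (by omega) (by omega) h5

/-- The behaviour of `±β` decides. If the `β`-coordinate can be lowered to a bounded value, by
injectivity of `-β` or by an `𝔰𝔩₂`-string, then `α ∈ 𝔅_M` is contradicted; if `β` is injective,
`unbounded_of_commuting` applies. -/
theorem unbounded_of_roots (hρ : IsRep ρ) (hfin : IsFiniteWeight ρ) (hsh : HasShadow ρ)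
    {α β δ' : Wt T} {e f y y' : Alg T} {h h' : cartan T} (t : IsTriple T α e f h)
    (t' : IsTriple T β y y' h') (hey : algBracket T e y = 0) (hβ : β h = 0) (hα : α h' = 0)
    (hαn : α ∈ nilRoots ρ) (hαi : ∀ z : ℤ, -α + (4 * z) • δ' ∈ injRoots ρ)
    (hβr : β ∈ realRoots T) (hβr' : -β ∈ realRoots T) {q q' : ℕ} (hq : 0 < q) (hq' : 0 < q')
    {lam : Wt T} {k : ℕ → ℤ}
    (hk : ∀ n : ℕ, 0 < n → lam + (n * q) • α + (n * q') • β + k n • δ' ∈ support ρ) (N : ℕ) :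
    ∃ ν : Wt T, N < Module.finrank ℂ (weightSpace ρ ν) := by
  obtain ⟨μ, hμ⟩ := exists_common_shift (fun z => ((hsh.2.2 ▸ hαi z : _ ∈ setC ρ ∩ _)).1) hq hk
  have hαB : α ∈ setB ρ := (hsh.2.1 ▸ hαn : α ∈ setB ρ ∩ _).1
  have hge : ∀ n : ℕ, n ≤ n * q := fun n => Nat.le_mul_of_pos_right n hq
  have hge' : ∀ n : ℕ, n ≤ n * q' := fun n => Nat.le_mul_of_pos_right n hq'
  have hβ' : -β ∈ injRoots ρ ∪ nilRoots ρ := hsh.1 ▸ hβr'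
  rcases hβ' with hβ' | hβ'
  · refine (false_of_mem_setB (ρ := ρ) (μ := μ) hαB fun C => ?_).elim
    -- `C + 1` compensates for the `α` lost in the common shift: `nq - 1 ≥ C`.
    obtain ⟨n, hn, -, hs⟩ := hμ (C + 1)
    refine ⟨n * q - 1, by have := hge n; omega, ?_⟩
    simpa using add_nsmul_mem_support (hsh.2.2 ▸ hβ' : -β ∈ setC ρ ∩ _).1 hs (n * q')
  rcases (hsh.1 ▸ hβr : β ∈ injRoots ρ ∪ nilRoots ρ) with hβi | hβn
  · have hαi0 : -α ∈ injRoots ρ := by simpa using hαi 0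
    refine unbounded_of_commuting hρ hfin t (hαn.2 _ t.e_mem t.e_ne)
      (hαi0.2 _ t.f_mem t.f_ne) t'.e_mem t'.e_even (hβi.2 _ t'.e_mem t'.e_ne) hey hβ
      (μ := μ) (fun C => ?_) N
    obtain ⟨n, hn, -, hs⟩ := hμ (C + 1)
    exact ⟨n * q - 1, n * q', by have := hge n; omega, hs⟩
  -- As `α(h') = 0`, the weight divided by `β(h')` is `μ(h')/β(h') + nq'` on `h'`, so the string
  -- goes down by `nq' - c` steps with `c` independent of `n`. The `β`-coordinate becomes the
  -- constant `c`.
  · obtain ⟨c, hc⟩ := exists_nat_gt (-(μ h' / β h').re)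
    refine (false_of_mem_setB (ρ := ρ) (μ := μ + c • β) hαB fun C => ?_).elim
    obtain ⟨n, hn, -, hs⟩ := hμ (C + c + 1)
    have hcn : c ≤ n * q' := by have := hge' n; omega
    refine ⟨n * q - 1, by have := hge n; omega, ?_⟩
    have h1 := sub_mem_support_of_nilpotent hρ t' (hβn.2 _ t'.e_mem t'.e_ne) hs
      (j := n * q' - c) (by
        simp only [LinearMap.add_apply, LinearMap.smul_apply, hα, smul_zero, add_zero]
        rw [add_div, Complex.add_re, nsmul_eq_mul, mul_div_cancel_right₀ _ t'.apply_ne,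
          Complex.natCast_re, Nat.cast_sub hcn]
        linarith)
    have h2 : μ + c • β + (n * q - 1) • α =
        μ + (n * q - 1) • α + (n * q') • β - (n * q' - c) • β := by
      conv_rhs => rw [← Nat.add_sub_cancel' hcn, add_smul, Nat.add_sub_cancel_left]
      abel
    rwa [h2]

theorem false_of_root_multiples (hsh : HasShadow ρ) {α δ' : Wt T} (hαn : α ∈ nilRoots ρ)
    (hαi : ∀ z : ℤ, -α + (4 * z) • δ' ∈ injRoots ρ) {q : ℕ} (hq : 0 < q)
    {lam : Wt T} {k : ℕ → ℤ}
    (hk : ∀ n : ℕ, 0 < n → lam + (n * q) • α + k n • δ' ∈ support ρ) : False := by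
  obtain ⟨μ, hμ⟩ := exists_common_shift (ν := fun _ => 0)
    (fun z => ((hsh.2.2 ▸ hαi z : _ ∈ setC ρ ∩ _)).1) hq (by simpa using hk)
  refine false_of_mem_setB (ρ := ρ) (μ := μ) (hsh.2.1 ▸ hαn : α ∈ setB ρ ∩ _).1 fun C => ?_
  obtain ⟨n, hn, -, hs⟩ := hμ (C + 1)
  exact ⟨n * q - 1, by have := Nat.le_mul_of_pos_right n hq; omega, by simpa using hs⟩

end modules

/-! ### Elementary matrices and the root vectors for `2 w_u`. -/

section matrices

variable {T : AffineType}

/-- The basis vector with this index has nonzero weight. -/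
def HasWeight : Idx T → Prop
  | .inl _ => True
  | .inr (.inl _) => True
  | _ => False

theorem HasWeight.bar_ne {u : Idx T} (hu : HasWeight u) : bar u ≠ u := by
  rcases u with ⟨i, _ | _⟩ | ⟨j, _ | _⟩ | z | z <;> simp_all [HasWeight, bar]

theorem HasWeight.swap_eq {u : Idx T} (hu : HasWeight u) : swap u = u := by
  rcases u with ⟨i, s⟩ | ⟨j, s⟩ | z | z <;> simp_all [HasWeight, swap]

theorem HasWeight.bar {u : Idx T} (hu : HasWeight u) : HasWeight (bar u) := by
  rcases u with ⟨i, s⟩ | ⟨j, s⟩ | z | z <;> simp_all [HasWeight, TwistedAffine.bar]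

theorem bar_inj {a b : Idx T} : bar a = bar b ↔ a = b := barEquiv.apply_eq_iff_eq

theorem negAdj_single (a b : Idx T) (x : ℂ) :
    negAdj T (Matrix.single a b x) = Matrix.single (bar b) (bar a)
      (-(pairing b * pairing a * (-1) ^ (par b * (par b + par a)) * x)) := by
  ext a' b'
  rw [negAdj_apply]
  by_cases h : bar b = a' ∧ bar a = b'
  · obtain ⟨rfl, rfl⟩ := h
    simp [bar_bar, par_bar]
  · have h' : ¬(a = bar b' ∧ b = bar a') := by
      rintro ⟨rfl, rfl⟩
      exact h (by simp [bar_bar])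
    rw [Matrix.single_apply_of_ne _ _ _ _ _ h, Matrix.single_apply_of_ne _ _ _ _ _ h']
    simp

theorem swapConj_single (a b : Idx T) (x : ℂ) :
    swapConj T (Matrix.single a b x) = Matrix.single (swap a) (swap b) x := by
  ext a' b'
  change Matrix.single a b x (swap a') (swap b') = _
  by_cases h : swap a = a' ∧ swap b = b'
  · obtain ⟨rfl, rfl⟩ := h
    simp [swap_swap]
  · have h' : ¬(a = swap a' ∧ b = swap b') := by
      rintro ⟨rfl, rfl⟩
      exact h (by simp [swap_swap])
    rw [Matrix.single_apply_of_ne _ _ _ _ _ h, Matrix.single_apply_of_ne _ _ _ _ _ h']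

theorem str_single (a b : Idx T) (x : ℂ) :
    str T (Matrix.single a b x) = if a = b then (-1) ^ par a * x else 0 := by
  change ∑ c, (-1 : ℂ) ^ par c * Matrix.single a b x c c = _
  rw [Finset.sum_eq_single a]
  · by_cases h : a = b <;> simp [h, Matrix.single_apply]
    intro h'
    exact absurd h'.symm h
  · intro c _ hc
    simp [Ne.symm hc]
  · simp

/-- The even matrices of `𝔤𝔩(V)`. -/
def IsEven (X : SMat T) : Prop := ∀ a b, (par a + par b) % 2 ≠ (0 : Fin 2).val → X a b = 0

theorem isEven_single {a b : Idx T} (h : par a = par b) (x : ℂ) : IsEven (Matrix.single a b x) := by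
  intro a' b' h'
  refine Matrix.single_apply_of_ne _ _ _ _ _ ?_
  rintro ⟨rfl, rfl⟩
  exact h' (by rw [h, ← two_mul]; simp)

theorem IsEven.add {X Y : SMat T} (hX : IsEven X) (hY : IsEven Y) : IsEven (X + Y) :=
  fun a b h => by rw [Matrix.add_apply, hX a b h, hY a b h, add_zero]

theorem IsEven.sub {X Y : SMat T} (hX : IsEven X) (hY : IsEven Y) : IsEven (X - Y) :=
  fun a b h => by rw [Matrix.sub_apply, hX a b h, hY a b h, sub_zero]

/-- The sign differs from the ordinary commutator only in terms containing an odd entry of `X`. -/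
theorem glBracket_of_isEven {X : SMat T} (hX : IsEven X) (Y : SMat T) :
    glBracket T X Y = X * Y - Y * X := by
  ext a b
  rw [glBracket_apply, Matrix.sub_apply, Matrix.mul_apply, Matrix.mul_apply,
    ← Finset.sum_sub_distrib]
  refine Finset.sum_congr rfl fun c _ => ?_
  rcases par_eq a with ha | ha <;> rcases par_eq b with hb | hb <;>
    rcases par_eq c with hc | hc <;> rw [ha, hb, hc] <;>
    first
    | (norm_num; done)
    | (rw [hX c b (by simp [hb, hc])]; ring)

theorem diagonal_comm_single (d : Idx T → ℂ) (a b : Idx T) (x : ℂ) :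
    Matrix.diagonal d * Matrix.single a b x - Matrix.single a b x * Matrix.diagonal d =
      (d a - d b) • Matrix.single a b x := by
  ext a' b'
  simp only [Matrix.sub_apply, Matrix.diagonal_mul, Matrix.mul_diagonal, Matrix.smul_apply,
    Matrix.single_apply, smul_eq_mul]
  split_ifs with h
  · obtain ⟨rfl, rfl⟩ := h
    ring
  · simp

/-- Even matrices that represent root vectors for `r w_u` and `- r w_u` (where `w_u` is the weight
of the basis vector `v_u`), of degrees `p` and `-p`, and span an `𝔰𝔩₂` with the coroot of `w_u`. -/
structure IsRootPair (T : AffineType) (u : Idx T) (r : ℕ) (p : ℤ) (E F : SMat T) : Prop where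
  mem_E : E ∈ matrixAlg T
  mem_F : F ∈ matrixAlg T
  even_E : IsEven E
  even_F : IsEven F
  aut_E : glAut T E = T.family.root ^ p • E
  aut_F : glAut T F = T.family.root ^ (-p) • F
  weight_E : ∀ d : Idx T → ℂ, Matrix.diagonal d ∈ matrixAlg T →
    (∃ c : ℂ, glAut T (Matrix.diagonal d) = Matrix.diagonal d + c • 1) →
    Matrix.diagonal d * E - E * Matrix.diagonal d = (r * ((d u - d (bar u)) / 2)) • E
  weight_F : ∀ d : Idx T → ℂ, Matrix.diagonal d ∈ matrixAlg T →
    (∃ c : ℂ, glAut T (Matrix.diagonal d) = Matrix.diagonal d + c • 1) →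
    Matrix.diagonal d * F - F * Matrix.diagonal d = -(r * ((d u - d (bar u)) / 2)) • F
  commutator : ∃ c : ℂ, c ≠ 0 ∧
    E * F - F * E = c • (Matrix.single u u 1 - Matrix.single (bar u) (bar u) 1)

theorem matrixAlg_eq (h : T.family ≠ .orth) : matrixAlg T = LinearMap.ker (str T) := by
  obtain ⟨F, k, l, s⟩ := T
  cases F <;> first | rfl | exact absurd rfl h

theorem glAut_eq (h : T.family ≠ .orth) : glAut T = negAdj T := by
  obtain ⟨F, k, l, s⟩ := T
  cases F <;> first | rfl | exact absurd rfl h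

theorem mem_matrixAlg_orth (h : T.family = .orth) {X : SMat T} :
    X ∈ matrixAlg T ↔ negAdj T X = X := by
  obtain ⟨F, k, l, s⟩ := T
  subst h
  simp [matrixAlg, sub_eq_zero]

theorem glAut_orth (h : T.family = .orth) : glAut T = swapConj T := by
  obtain ⟨F, k, l, s⟩ := T
  subst h
  rfl

theorem pairing_mul_pairing_bar {u : Idx T} (hu : HasWeight u) :
    pairing u * pairing (bar u) = (-1) ^ par u := by
  rcases u with ⟨i, _ | _⟩ | ⟨j, _ | _⟩ | z | z <;> simp_all [HasWeight, bar, pairing, par]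

theorem negAdj_single_bar {u : Idx T} (hu : HasWeight u) :
    negAdj T (Matrix.single u (bar u) 1) = (-(-1) ^ par u : ℂ) • Matrix.single u (bar u) 1 := by
  rw [negAdj_single, bar_bar, mul_comm (pairing _), pairing_mul_pairing_bar hu, par_bar,
    Matrix.smul_single]
  rcases par_eq u with h | h <;> rw [h] <;> norm_num

/-- The degree of the root vector for the root `2 ε_i`, and for `2 δ_j`. -/
def longDegree (T : AffineType) (u : Idx T) : ℤ :=
  if par u = 1 then 0 else match T.family with
    | .evenEven => 2
    | _ => 1

theorem root_zpow_longDegree {u : Idx T} :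
    T.family.root ^ longDegree T u = -(-1) ^ par u ∧
      T.family.root ^ (-longDegree T u) = -(-1) ^ par u := by
  have hI : (Complex.I : ℂ) ^ (2 : ℤ) = -1 := by
    rw [zpow_ofNat, Complex.I_sq]
  have h1 : T.family.root ^ longDegree T u = -(-1) ^ par u := by
    obtain ⟨F, k, l, s⟩ := T
    rcases par_eq u with h | h <;> cases F <;> simp [longDegree, h, Family.root, hI]
  refine ⟨h1, ?_⟩
  rw [zpow_neg, h1]
  rcases par_eq u with h | h <;> rw [h] <;> norm_num

/-- The matrix unit at `(u, ū)` is an eigenvector of `negAdj` with eigenvalue `-(-1)^{|u|}`. In type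
`A` this is the eigenvalue of `σ` and dictates the degree; in the family `orth` it must be 1 for the
matrix to lie in `𝔬𝔰𝔭`, so `u` must be odd. -/
theorem isRootPair_long {u : Idx T} (hu : HasWeight u) (h : T.family = .orth → par u = 1) :
    IsRootPair T u 2 (longDegree T u) (Matrix.single u (bar u) 1)
      (Matrix.single (bar u) u 1) := by
  have hmem : ∀ v : Idx T, HasWeight v → par v = par u →
      Matrix.single v (bar v) (1 : ℂ) ∈ matrixAlg T := fun v hv hvu => by
    by_cases ho : T.family = .orth
    · rw [mem_matrixAlg_orth ho, negAdj_single_bar hv, hvu, h ho]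
      simp
    · rw [matrixAlg_eq ho, LinearMap.mem_ker, str_single, if_neg hv.bar_ne.symm]
  have haut : ∀ v : Idx T, HasWeight v → par v = par u →
      glAut T (Matrix.single v (bar v) (1 : ℂ)) =
        (-(-1) ^ par u : ℂ) • Matrix.single v (bar v) 1 := fun v hv hvu => by
    by_cases ho : T.family = .orth
    · rw [glAut_orth ho, swapConj_single, hv.swap_eq, hv.bar.swap_eq, h ho]
      simp
    · rw [glAut_eq ho, negAdj_single_bar hv, hvu]
  have hb := hmem (bar u) hu.bar (par_bar u)
  have hb' := haut (bar u) hu.bar (par_bar u)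
  rw [bar_bar] at hb hb'
  refine ⟨hmem u hu rfl, hb, isEven_single (par_bar u).symm 1, isEven_single (par_bar u) 1,
    ?_, ?_, fun d _ _ => ?_, fun d _ _ => ?_, 1, one_ne_zero, ?_⟩
  · rw [haut u hu rfl, root_zpow_longDegree.1]
  · rw [hb', root_zpow_longDegree.2]
  · rw [diagonal_comm_single]
    congr 1
    push_cast
    ring
  · rw [diagonal_comm_single]
    congr 1
    push_cast
    ring
  · simp

end matrices

/-! ### The short root vectors for `±ε_i` in the family `orth`. -/

section orth

variable {T : AffineType}

/-- The indices of the two vectors of weight zero in the family `orth`. -/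
structure IsZeroPair (z z' : Idx T) : Prop where
  family_eq : T.family = .orth
  bar_left : bar z = z'
  bar_right : bar z' = z
  swap_left : swap z = z'
  swap_right : swap z' = z
  par_left : par z = 0
  par_right : par z' = 0
  pairing_left : pairing z = 1
  pairing_right : pairing z' = 1
  ne : z ≠ z'
  not_hasWeight_left : ¬ HasWeight z
  not_hasWeight_right : ¬ HasWeight z'

theorem exists_isZeroPair (h : T.family = .orth) : ∃ z z' : Idx T, IsZeroPair z z' := by
  obtain ⟨F, k, l, s⟩ := T
  subst h
  refine ⟨.inr (.inr (.inl (0 : Fin 2))), .inr (.inr (.inl (1 : Fin 2))),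
    rfl, rfl, rfl, rfl, rfl, rfl, rfl, rfl, rfl, fun h => ?_, id, id⟩
  simp only [Sum.inr.injEq] at h
  exact absurd h (by decide)

theorem pairing_eq_one {u : Idx T} (hu : par u = 0) : pairing u = 1 := by
  rcases u with ⟨i, s⟩ | ⟨j, s⟩ | z | z <;> simp_all [par, pairing]

/-- The root vector for `w_u` in `𝔬𝔰𝔭(2k+2|2ℓ)` that the exchange of the two vectors of weight zero
multiplies by `s = ±1`. -/
def shortMat (z z' : Idx T) (s : ℂ) (u : Idx T) : SMat T :=
  Matrix.single u z 1 + Matrix.single u z' s -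
    Matrix.single z' (bar u) 1 - Matrix.single z (bar u) s

variable {z z' : Idx T}

theorem negAdj_shortMat (hz : IsZeroPair z z') {s : ℂ} {u : Idx T} (hu : par u = 0) :
    negAdj T (shortMat z z' s u) = shortMat z z' s u := by
  have hb : par (bar u) = 0 := (par_bar u).trans hu
  simp only [shortMat, map_add, map_sub, negAdj_single, bar_bar, hz.bar_left, hz.bar_right,
    pairing_eq_one hu, pairing_eq_one hb, hz.pairing_left, hz.pairing_right, hu, hb,
    hz.par_left, hz.par_right, add_zero, mul_one, zero_mul, one_mul, pow_zero]
  simp only [← Matrix.single_neg]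
  abel

theorem swapConj_shortMat (hz : IsZeroPair z z') {s : ℂ} (hs : s * s = 1) {u : Idx T}
    (hu : HasWeight u) :
    swapConj T (shortMat z z' s u) = s • shortMat z z' s u := by
  simp only [shortMat, map_add, map_sub, swapConj_single, smul_sub, smul_add,
    Matrix.smul_single, smul_eq_mul, hs, mul_one, hu.swap_eq, hu.bar.swap_eq, hz.swap_left,
    hz.swap_right]
  abel

theorem isEven_shortMat (hz : IsZeroPair z z') {s : ℂ} {u : Idx T} (hu : par u = 0) :
    IsEven (shortMat z z' s u) := by
  have hb : par (bar u) = 0 := (par_bar u).trans hu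
  exact (((isEven_single (hu.trans hz.par_left.symm) _).add
    (isEven_single (hu.trans hz.par_right.symm) _)).sub
    (isEven_single (hz.par_right.trans hb.symm) _)).sub
    (isEven_single (hz.par_left.trans hb.symm) _)

theorem diagonal_comm_shortMat (hz : IsZeroPair z z') {s : ℂ} {u : Idx T} (hu : HasWeight u)
    (d : Idx T → ℂ)
    (hd : Matrix.diagonal d ∈ matrixAlg T)
    (hd' : ∃ r : ℂ, glAut T (Matrix.diagonal d) = Matrix.diagonal d + r • 1) :
    Matrix.diagonal d * shortMat z z' s u - shortMat z z' s u * Matrix.diagonal d =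
      ((d u - d (bar u)) / 2) • shortMat z z' s u := by
  rw [mem_matrixAlg_orth hz.family_eq] at hd
  obtain ⟨r, hr⟩ := hd'
  -- Membership in `𝔬𝔰𝔭` makes the entries at `a` and `ā` opposite. Invariance under the exchange
  -- holds a priori up to a scalar `r`, which vanishes by comparison at `u`. The two entries at `z`,
  -- `z'` are then both equal and opposite, hence zero.
  have h1 : ∀ a, d (bar a) = -d a := fun a => by
    have := congrFun₂ hd a a
    rw [negAdj_apply, pairing_sq] at this
    rcases par_eq a with h | h <;> simp [h] at this <;> linear_combination -this
  have h2 : ∀ a, d (swap a) = d a + r := fun a => by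
    have := congrFun₂ hr a a
    rw [glAut_orth hz.family_eq] at this
    change Matrix.diagonal d (swap a) (swap a) = _ at this
    simpa using this
  have hr0 : r = 0 := by simpa [hu.swap_eq] using h2 u
  have h3 : d z' = -d z := hz.bar_left ▸ h1 z
  have h4 : d z' = d z := by simpa [hr0, hz.swap_left] using h2 z
  have hz0 : d z = 0 := self_eq_neg.mp (h4.symm.trans h3)
  have hz0' : d z' = 0 := h4.trans hz0
  have h5 : (d u - d (bar u)) / 2 = d u := by rw [h1 u]; ring
  rw [h5]
  have key : ∀ X Y : SMat T, Matrix.diagonal d * X - X * Matrix.diagonal d =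
      d u • X → Matrix.diagonal d * Y - Y * Matrix.diagonal d = d u • Y →
      Matrix.diagonal d * (X + Y) - (X + Y) * Matrix.diagonal d = d u • (X + Y) ∧
      Matrix.diagonal d * (X - Y) - (X - Y) * Matrix.diagonal d = d u • (X - Y) :=
    fun X Y hX hY => by
      constructor
      · rw [smul_add, ← hX, ← hY, mul_add, add_mul]; abel
      · rw [smul_sub, ← hX, ← hY, mul_sub, sub_mul]; abel
  unfold shortMat
  refine (key _ _ (key _ _ (key _ _ ?_ ?_).1 ?_).2 ?_).2 <;> rw [diagonal_comm_single] <;>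
    congr 1 <;> simp only [h1 u, hz0, hz0'] <;> ring

/-- The entry at `(u, v̄)` collects the two paths through `z` and `z'`, which contribute `-s'` and
`-s`. Thus opposite signs cancel, and this is how commuting short root vectors are obtained. -/
theorem shortMat_mul (hz : IsZeroPair z z') {s s' : ℂ} {u v : Idx T} (hu : HasWeight u)
    (hv : HasWeight v) :
    shortMat z z' s u * shortMat z z' s' v =
      (-(s + s')) • Matrix.single u (bar v) 1 -
      if bar u = v then
        (Matrix.single z' z 1 + Matrix.single z' z' s' + Matrix.single z z s +
          Matrix.single z z' (s * s'))
      else 0 := by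
  have h1 : ∀ {w : Idx T}, HasWeight w → z ≠ w := fun hw h =>
    hz.not_hasWeight_left (h ▸ hw)
  have h2 : ∀ {w : Idx T}, HasWeight w → z' ≠ w := fun hw h =>
    hz.not_hasWeight_right (h ▸ hw)
  have e1 : ∀ (x y : ℂ) (a b : Idx T), Matrix.single a (bar u) x * Matrix.single v b y =
      if bar u = v then Matrix.single a b (x * y) else 0 := fun x y a b => by
    split_ifs with h
    · rw [h, Matrix.single_mul_single_same]
    · rw [Matrix.single_mul_single_of_ne _ _ _ _ h]
  unfold shortMat
  simp only [mul_add, add_mul, mul_sub, sub_mul, e1, Matrix.single_mul_single_same,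
    Matrix.single_mul_single_of_ne _ _ _ _ hz.ne, Matrix.single_mul_single_of_ne _ _ _ _ hz.ne.symm,
    Matrix.single_mul_single_of_ne _ _ _ _ (h1 hv), Matrix.single_mul_single_of_ne _ _ _ _ (h2 hv),
    Matrix.single_mul_single_of_ne _ _ _ _ (h1 hu.bar).symm,
    Matrix.single_mul_single_of_ne _ _ _ _ (h2 hu.bar).symm, neg_smul, add_smul,
    Matrix.smul_single, smul_eq_mul, mul_one, one_mul]
  split_ifs <;> abel

theorem isRootPair_short (hz : IsZeroPair z z') {s : ℂ} {p : ℤ} (hs : s * s = 1)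
    (hp : (-1 : ℂ) ^ p = s) {u : Idx T} (hu : HasWeight u) (hu' : par u = 0) :
    IsRootPair T u 1 p (shortMat z z' s u) (shortMat z z' s (bar u)) := by
  have hb : par (bar u) = 0 := (par_bar u).trans hu'
  have hp' : (-1 : ℂ) ^ (-p) = s := by
    rw [zpow_neg, hp]
    exact inv_eq_of_mul_eq_one_left hs
  have hroot : T.family.root = -1 := by rw [hz.family_eq]; rfl
  refine ⟨?_, ?_, isEven_shortMat hz hu', isEven_shortMat hz hb, ?_, ?_, fun d hd hd' => ?_,
    fun d hd hd' => ?_, -(2 * s), ?_, ?_⟩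
  · rw [mem_matrixAlg_orth hz.family_eq, negAdj_shortMat hz hu']
  · rw [mem_matrixAlg_orth hz.family_eq, negAdj_shortMat hz hb]
  · rw [glAut_orth hz.family_eq, swapConj_shortMat hz hs hu, hroot, hp]
  · rw [glAut_orth hz.family_eq, swapConj_shortMat hz hs hu.bar, hroot, hp']
  · rw [diagonal_comm_shortMat hz hu _ hd hd', Nat.cast_one, one_mul]
  · rw [diagonal_comm_shortMat hz hu.bar _ hd hd', Nat.cast_one, one_mul, bar_bar]
    congr 1
    ring
  · rw [neg_ne_zero]
    refine mul_ne_zero two_ne_zero ?_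
    rintro rfl
    simp at hs
  · rw [shortMat_mul hz hu hu.bar, shortMat_mul hz hu.bar hu, if_pos rfl, if_pos (bar_bar u),
      bar_bar, smul_sub, show -(2 * s) = -(s + s) by ring]
    abel

theorem shortMat_mul_neg (hz : IsZeroPair z z') {s : ℂ} {u v : Idx T} (hu : HasWeight u)
    (hv : HasWeight v) (huv : bar u ≠ v) : shortMat z z' s u * shortMat z z' (-s) v = 0 := by
  rw [shortMat_mul hz hu hv, if_neg huv]
  simp

theorem shortMat_mul_long (hz : IsZeroPair z z') {s : ℂ} {u v : Idx T} (hv : HasWeight v)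
    (huv' : u ≠ bar v) :
    shortMat z z' s u * Matrix.single v (bar v) 1 = 0 ∧
      Matrix.single v (bar v) 1 * shortMat z z' s u = 0 := by
  have h1 : ∀ {w : Idx T}, HasWeight w → z ≠ w := fun hw h =>
    hz.not_hasWeight_left (h ▸ hw)
  have h2 : ∀ {w : Idx T}, HasWeight w → z' ≠ w := fun hw h =>
    hz.not_hasWeight_right (h ▸ hw)
  have h3 : bar u ≠ v := fun h => huv' (by rw [← h, bar_bar])
  unfold shortMat
  constructor
  · simp only [add_mul, sub_mul, Matrix.single_mul_single_of_ne _ _ _ _ (h1 hv),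
      Matrix.single_mul_single_of_ne _ _ _ _ (h2 hv), Matrix.single_mul_single_of_ne _ _ _ _ h3]
    simp
  · simp only [mul_add, mul_sub, Matrix.single_mul_single_of_ne _ _ _ _ huv'.symm,
      Matrix.single_mul_single_of_ne _ _ _ _ (h1 hv.bar).symm,
      Matrix.single_mul_single_of_ne _ _ _ _ (h2 hv.bar).symm]
    simp

end orth

/-! ### Choice of the real multiples and of commuting root vectors. -/

section pairs

variable {T : AffineType}

/-- The smallest multiple of the weight of the basis vector with index `u` (which is nonzero) that
is the restriction of an even root in all families: `w_u` if `w_u = ± ε_i` in the family `orth`,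
and `2 w_u` otherwise. -/
def rootMult (T : AffineType) (u : Idx T) : ℕ :=
  match T.family with
  | .orth => if par u = 0 then 1 else 2
  | _ => 2

theorem rootMult_eq_two {u : Idx T} (h : T.family = .orth → par u = 1) : rootMult T u = 2 := by
  obtain ⟨F, k, l, s⟩ := T
  cases F <;> simp_all [rootMult]

theorem rootMult_eq_one {u : Idx T} (h : T.family = .orth) (hu : par u = 0) :
    rootMult T u = 1 := by
  obtain ⟨F, k, l, s⟩ := T
  cases F <;> simp_all [rootMult]

theorem exists_isRootPair {u : Idx T} (hu : HasWeight u) :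
    ∃ p E F, IsRootPair T u (rootMult T u) p E F := by
  by_cases h : T.family = .orth ∧ par u = 0
  · obtain ⟨z, z', hz⟩ := exists_isZeroPair h.1
    rw [rootMult_eq_one h.1 h.2]
    exact ⟨0, _, _, isRootPair_short hz (s := 1) (by norm_num) (by norm_num) hu h.2⟩
  · have h' : T.family = .orth → par u = 1 := fun ho =>
      (par_eq u).resolve_left fun h0 => h ⟨ho, h0⟩
    rw [rootMult_eq_two h']
    exact ⟨_, _, _, isRootPair_long hu h'⟩

/-- If at least one vector is long, the products vanish because no indices match. Two short vectors
of equal sign would produce a multiple of a root vector for `w_u + w_v`; taking the signs `1` and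
`-1`, that is, degrees 0 and 1, makes the products zero. -/
theorem exists_isRootPair_commuting {u v : Idx T} (hu : HasWeight u) (hv : HasWeight v)
    (huv' : u ≠ bar v) :
    ∃ p E F q E' F', IsRootPair T u (rootMult T u) p E F ∧
      IsRootPair T v (rootMult T v) q E' F' ∧ E * E' = 0 ∧ E' * E = 0 := by
  have h3 : bar u ≠ v := fun h => huv' (by rw [← h, bar_bar])
  by_cases h : T.family = .orth ∧ par u = 0 <;> by_cases h' : T.family = .orth ∧ par v = 0
  · obtain ⟨z, z', hz⟩ := exists_isZeroPair h.1
    rw [rootMult_eq_one h.1 h.2, rootMult_eq_one h'.1 h'.2]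
    refine ⟨0, _, _, 1, _, _, isRootPair_short hz (s := 1) (by norm_num) (by norm_num) hu h.2,
      isRootPair_short hz (s := -1) (by norm_num) (by norm_num) hv h'.2,
      shortMat_mul_neg hz hu hv h3, ?_⟩
    simpa using shortMat_mul_neg hz (s := -1) hv hu huv'.symm
  · obtain ⟨z, z', hz⟩ := exists_isZeroPair h.1
    have k' : T.family = .orth → par v = 1 := fun ho =>
      (par_eq v).resolve_left fun h0 => h' ⟨ho, h0⟩
    rw [rootMult_eq_one h.1 h.2, rootMult_eq_two k']
    have := shortMat_mul_long hz (s := 1) hv huv'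
    exact ⟨0, _, _, _, _, _, isRootPair_short hz (s := 1) (by norm_num) (by norm_num) hu h.2,
      isRootPair_long hv k', this.1, this.2⟩
  · obtain ⟨z, z', hz⟩ := exists_isZeroPair h'.1
    have k' : T.family = .orth → par u = 1 := fun ho =>
      (par_eq u).resolve_left fun h0 => h ⟨ho, h0⟩
    rw [rootMult_eq_one h'.1 h'.2, rootMult_eq_two k']
    have := shortMat_mul_long hz (s := 1) hu h3.symm
    exact ⟨_, _, _, 0, _, _, isRootPair_long hu k',
      isRootPair_short hz (s := 1) (by norm_num) (by norm_num) hv h'.2, this.2, this.1⟩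
  · have k : T.family = .orth → par u = 1 := fun ho =>
      (par_eq u).resolve_left fun h0 => h ⟨ho, h0⟩
    have k' : T.family = .orth → par v = 1 := fun ho =>
      (par_eq v).resolve_left fun h0 => h' ⟨ho, h0⟩
    rw [rootMult_eq_two k, rootMult_eq_two k']
    exact ⟨_, _, _, _, _, _, isRootPair_long hu k, isRootPair_long hv k',
      Matrix.single_mul_single_of_ne _ _ _ _ h3 _,
      Matrix.single_mul_single_of_ne _ _ _ _ huv'.symm _⟩

end pairs

/-! ### Root vectors, coroots and triples in the affine algebra. -/

section algebra

variable {T : AffineType}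

/-- The class of a matrix in `𝔤`. -/
def cls (X : SMat T) (hX : X ∈ matrixAlg T) : FinAlg T := (scalars T).mkQ ⟨X, hX⟩

theorem bracket_cls {X Y Z : SMat T} (hX : X ∈ matrixAlg T) (hY : Y ∈ matrixAlg T)
    (hZ : Z ∈ matrixAlg T) (he : IsEven X) (h : X * Y - Y * X = Z) :
    bracket T (cls X hX) (cls Y hY) = cls Z hZ := by
  change (scalars T).mkQ ⟨glBracket T X Y, _⟩ = (scalars T).mkQ ⟨Z, hZ⟩
  congr 1
  exact Subtype.ext ((glBracket_of_isEven he Y).trans h)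

theorem kappa_cls {X Y : SMat T} (hX : X ∈ matrixAlg T) (hY : Y ∈ matrixAlg T) :
    kappa T (cls X hX) (cls Y hY) = T.scale * str T (X * Y) := rfl

theorem diagCoord_cls (a : Idx T) {X : SMat T} (hX : X ∈ matrixAlg T) :
    diagCoord T a (cls X hX) = (X a a - X (bar a) (bar a)) / 2 := rfl

theorem cls_smul (c : ℂ) {X : SMat T} (hX : X ∈ matrixAlg T) :
    cls (c • X) (Submodule.smul_mem _ c hX) = c • cls X hX := rfl

theorem sigma_cls {X : SMat T} (hX : X ∈ matrixAlg T) {c : ℂ} (h : glAut T X = c • X) :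
    sigma T (cls X hX) = c • cls X hX := by
  change (scalars T).mkQ ⟨glAut T X, _⟩ = (scalars T).mkQ (c • ⟨X, hX⟩)
  congr 1
  exact Subtype.ext h

theorem cls_mem_finPart {X : SMat T} (hX : X ∈ matrixAlg T) (he : IsEven X) :
    cls X hX ∈ finPart T 0 :=
  Submodule.mem_map.mpr ⟨⟨X, hX⟩, he, rfl⟩

/-- The matrix of the coroot of the weight of the basis vector with index `u`, up to a factor. -/
def corootMat (u : Idx T) : SMat T := Matrix.single u u 1 - Matrix.single (bar u) (bar u) 1

theorem negAdj_corootMat (u : Idx T) : negAdj T (corootMat u) = corootMat u := by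
  unfold corootMat
  rw [map_sub, negAdj_single, negAdj_single, pairing_sq, pairing_sq, bar_bar, par_bar]
  rcases par_eq u with h | h <;> simp [h, ← Matrix.single_neg] <;> abel

theorem corootMat_mem (u : Idx T) : corootMat u ∈ matrixAlg T := by
  by_cases h : T.family = .orth
  · rw [mem_matrixAlg_orth h, negAdj_corootMat]
  · rw [matrixAlg_eq h, LinearMap.mem_ker, corootMat, map_sub, str_single, str_single, par_bar]
    simp

theorem glAut_corootMat {u : Idx T} (hu : HasWeight u) : glAut T (corootMat u) = corootMat u := by
  by_cases h : T.family = .orth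
  · rw [glAut_orth h, corootMat, map_sub, swapConj_single, swapConj_single, hu.swap_eq,
      hu.bar.swap_eq]
  · rw [glAut_eq h, negAdj_corootMat]

/-- The coroot of the weight of the basis vector with index `u`, up to a factor. -/
def coroot (u : Idx T) : FinAlg T := cls (corootMat u) (corootMat_mem u)

theorem coroot_mem_finCartan (u : Idx T) : coroot u ∈ finCartan T := by
  refine Submodule.mem_map.mpr ⟨⟨corootMat u, corootMat_mem u⟩, fun a b hab => ?_, rfl⟩
  change corootMat u a b = 0
  rw [corootMat, Matrix.sub_apply, Matrix.single_apply_of_ne, Matrix.single_apply_of_ne, sub_zero]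
  · rintro ⟨rfl, rfl⟩
    exact hab rfl
  · rintro ⟨rfl, rfl⟩
    exact hab rfl

theorem sigma_coroot {u : Idx T} (hu : HasWeight u) : sigma T (coroot u) = coroot u := by
  exact (sigma_cls (corootMat_mem u) (c := 1) (by rw [glAut_corootMat hu, one_smul])).trans
    (one_smul ℂ _)

theorem diagCoord_coroot_self {u : Idx T} (hu : HasWeight u) :
    diagCoord T u (coroot u) = 1 := by
  rw [coroot, diagCoord_cls, corootMat]
  simp [hu.bar_ne, hu.bar_ne.symm]

theorem diagCoord_coroot_of_ne {u v : Idx T} (h : u ≠ v) (h' : u ≠ bar v) :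
    diagCoord T u (coroot v) = 0 := by
  have h1 : bar u ≠ v := fun h => h' (by rw [← h, bar_bar])
  rw [coroot, diagCoord_cls, corootMat]
  simp [h.symm, h'.symm, h1.symm, bar_inj]

theorem single_mul_diagonal (a : Idx T) (d : Idx T → ℂ) :
    Matrix.single a a 1 * Matrix.diagonal d = Matrix.single a a (d a) := by
  ext a' b'
  simp only [Matrix.mul_diagonal, Matrix.single_apply]
  split_ifs with h
  · rw [h.2, one_mul]
  · rw [zero_mul]

theorem diagonal_mul_single (a : Idx T) (d : Idx T → ℂ) :
    Matrix.diagonal d * Matrix.single a a 1 = Matrix.single a a (d a) := by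
  ext a' b'
  simp only [Matrix.diagonal_mul, Matrix.single_apply]
  split_ifs with h
  · rw [h.1, mul_one]
  · rw [mul_zero]

/-- The entries at `u` and `ū` have the same parity and enter with opposite signs, so pairing with
the coroot is a nonzero multiple of `w_u` whenever `scale` is nonzero. -/
theorem kappa_coroot (u : Idx T) {d : Idx T → ℂ} (hd : Matrix.diagonal d ∈ matrixAlg T) :
    kappa T (coroot u) (cls _ hd) =
        2 * T.scale * (-1) ^ par u * diagCoord T u (cls _ hd) ∧
      kappa T (cls _ hd) (coroot u) =
        2 * T.scale * (-1) ^ par u * diagCoord T u (cls _ hd) := by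
  rw [coroot, kappa_cls, kappa_cls, diagCoord_cls, corootMat, sub_mul, mul_sub,
    single_mul_diagonal, single_mul_diagonal, diagonal_mul_single, diagonal_mul_single, map_sub,
    str_single, str_single, if_pos rfl, if_pos rfl, par_bar, Matrix.diagonal_apply_eq,
    Matrix.diagonal_apply_eq]
  constructor <;> ring

/-- The scalar `c` is unavoidable at this level: an element of degree zero is fixed by `σ` only
modulo scalar matrices. -/
theorem exists_diagonal (h : cartan T) : ∃ (d : Idx T → ℂ) (hd : Matrix.diagonal d ∈ matrixAlg T),
    h.1.1.1 = Finsupp.single 0 (cls _ hd) ∧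
      ∃ c : ℂ, glAut T (Matrix.diagonal d) = Matrix.diagonal d + c • 1 := by
  obtain ⟨⟨D, hD⟩, hdiag, hDh⟩ := Submodule.mem_map.mp h.2.1
  have hDd : D = Matrix.diagonal fun a => D a a := by
    ext a b
    by_cases hab : a = b
    · subst hab; simp
    · rw [Matrix.diagonal_apply_ne _ hab]
      exact hdiag a b hab
  have hd : Matrix.diagonal (fun a => D a a) ∈ matrixAlg T := hDd ▸ hD
  have h0 : h.1.1.1 0 = cls _ hd := by
    rw [← hDh]
    change cls D hD = _
    congr 1
  refine ⟨_, hd, ?_, ?_⟩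
  · ext p
    by_cases hp : p = 0
    · subst hp
      rw [h0, Finsupp.single_eq_same]
    · rw [h.2.2 p hp, Finsupp.single_eq_of_ne hp]
  · have h1 := h.1.2 0
    rw [h0, zpow_zero, one_smul] at h1
    have h2 := (Submodule.Quotient.eq (scalars T)).mp h1
    obtain ⟨c, hc⟩ := mem_scalars h2
    exact ⟨c, by rw [← hc]; exact (add_sub_cancel _ _).symm⟩

theorem wtOf_apply (a : Idx T) (h : cartan T) : wtOf T a h = diagCoord T a (h.1.1.1 0) := rfl

theorem delta_apply (h : cartan T) : delta T h = h.1.1.2.2 := rfl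

theorem wtOf_bar (a : Idx T) : wtOf T (bar a) = -wtOf T a := by
  refine LinearMap.ext fun h => ?_
  obtain ⟨d, hd, hh, -⟩ := exists_diagonal h
  rw [LinearMap.neg_apply, wtOf_apply, wtOf_apply, hh, Finsupp.single_eq_same, diagCoord_cls,
    diagCoord_cls, bar_bar]
  ring

/-- The element `x ⊗ t^p` of `𝓛`. -/
noncomputable def loop (x : FinAlg T) (p : ℤ) (hx : sigma T x = T.family.root ^ p • x) : Alg T :=
  ⟨(Finsupp.single p x, 0, 0), fun q => by
    by_cases h : q = p
    · subst h
      simpa using hx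
    · simp [Finsupp.single_eq_of_ne h]⟩

theorem loop_ne_zero {x : FinAlg T} (h0 : x ≠ 0) (p : ℤ)
    (hx : sigma T x = T.family.root ^ p • x) : loop x p hx ≠ 0 := fun h => by
  have h1 := congrArg (fun u : Alg T => u.1.1 p) h
  change Finsupp.single p x p = 0 at h1
  rw [Finsupp.single_eq_same] at h1
  exact h0 h1

theorem loop_even {x : FinAlg T} (h0 : x ∈ finPart T 0) (p : ℤ)
    (hx : sigma T x = T.family.root ^ p • x) : loop x p hx ∈ algPart T 0 := by
  refine ⟨fun q => ?_, fun h => absurd h (by decide)⟩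
  change Finsupp.single p x q ∈ _
  by_cases h : q = p
  · rw [h, Finsupp.single_eq_same]
    exact h0
  · rw [Finsupp.single_eq_of_ne h]
    exact zero_mem _

theorem ambBracket_single (p q : ℤ) (x y : FinAlg T) (a b : ℂ) :
    ambBracket T (Finsupp.single p x, a, b) (Finsupp.single q y, 0, 0) =
      (Finsupp.single (p + q) (bracket T x y) + b • Finsupp.single q ((q : ℂ) • y),
        if p + q = 0 then (p : ℂ) * kappa T x y else 0, 0) := by
  have hdeg : degDer T (Finsupp.single q y) = Finsupp.single q ((q : ℂ) • y) := by
    unfold degDer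
    rw [Finsupp.sum_single_index (by simp)]
  unfold ambBracket
  simp only [hdeg, zero_smul, sub_zero]
  rw [Finsupp.sum_single_index (by simp), Finsupp.sum_single_index (by simp),
    Finsupp.sum_single_index (by simp), Finsupp.sum_single_index (by simp)]

theorem loop_mem_rootSpace {x : FinAlg T} {p : ℤ} (hx : sigma T x = T.family.root ^ p • x)
    {φ : Wt T} (h : ∀ h : cartan T, bracket T (h.1.1.1 0) x = φ h • x) :
    loop x p hx ∈ rootSpace T (φ + p • delta T) := by
  intro g
  obtain ⟨d, hd, hg, -⟩ := exists_diagonal g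
  have h1 := h g
  rw [hg, Finsupp.single_eq_same] at h1
  refine Subtype.ext ?_
  change ambBracket T (g.1.1.1, g.1.1.2.1, g.1.1.2.2) (Finsupp.single p x, 0, 0) =
    (_ • Finsupp.single p x, _ • (0 : ℂ), _ • (0 : ℂ))
  rw [hg, ambBracket_single, h1, zero_add, Int.cast_zero, zero_mul, ite_self, smul_zero]
  refine Prod.ext ?_ rfl
  rw [LinearMap.add_apply, LinearMap.smul_apply, delta_apply, Finsupp.smul_single,
    ← Finsupp.single_add, Finsupp.smul_single, smul_smul, add_smul, zsmul_eq_mul,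
    mul_comm (p : ℂ)]

/-- The chosen root of unity has order 2 or 4, so 4 is a period of the eigenspaces in every family.
This is the source of the translations by `4zδ`. -/
theorem root_zpow_add_four_mul (p z : ℤ) :
    T.family.root ^ (p + 4 * z) = T.family.root ^ p := by
  have h4 : T.family.root ^ (4 : ℤ) = 1 := by
    rw [zpow_ofNat]
    cases T.family
    case evenEven => exact Complex.I_pow_four
    all_goals norm_num [Family.root]
  rw [zpow_add₀ (root_ne_zero _), zpow_mul, h4, one_zpow, mul_one]

/-! ### Real roots -/

variable {u : Idx T} {r : ℕ} {p : ℤ} {E F : SMat T}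

theorem IsRootPair.exists_bracket_eq (hp : IsRootPair T u r p E F) :
    ∃ c : ℂ, c ≠ 0 ∧ bracket T (cls E hp.mem_E) (cls F hp.mem_F) = c • coroot u := by
  obtain ⟨c, hc, h⟩ := hp.commutator
  refine ⟨c, hc, ?_⟩
  rw [bracket_cls hp.mem_E hp.mem_F (Submodule.smul_mem _ c (corootMat_mem u)) hp.even_E h,
    cls_smul]
  rfl

theorem coroot_ne_zero (hu : HasWeight u) : coroot u ≠ 0 := fun h => by
  have := diagCoord_coroot_self hu
  rw [h, map_zero] at this
  exact zero_ne_one this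

theorem IsRootPair.E_ne_zero (hp : IsRootPair T u r p E F) (hu : HasWeight u) :
    cls E hp.mem_E ≠ 0 := fun h => by
  obtain ⟨c, hc, h1⟩ := hp.exists_bracket_eq
  rw [h, map_zero, LinearMap.zero_apply] at h1
  exact smul_ne_zero hc (coroot_ne_zero hu) h1.symm

theorem IsRootPair.F_ne_zero (hp : IsRootPair T u r p E F) (hu : HasWeight u) :
    cls F hp.mem_F ≠ 0 := fun h => by
  obtain ⟨c, hc, h1⟩ := hp.exists_bracket_eq
  rw [h, map_zero] at h1
  exact smul_ne_zero hc (coroot_ne_zero hu) h1.symm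

theorem isEven_diagonal (d : Idx T → ℂ) : IsEven (Matrix.diagonal d) := fun a b h =>
  Matrix.diagonal_apply_ne _ (by rintro rfl; exact h (by simp [← two_mul]))

theorem IsRootPair.cartan_bracket_E (hp : IsRootPair T u r p E F) (h : cartan T) :
    bracket T (h.1.1.1 0) (cls E hp.mem_E) = (r • wtOf T u) h • cls E hp.mem_E := by
  obtain ⟨d, hd, hh, hd'⟩ := exists_diagonal h
  rw [hh, Finsupp.single_eq_same, bracket_cls hd hp.mem_E (Submodule.smul_mem _ _ hp.mem_E)
    (isEven_diagonal d) (hp.weight_E d hd hd'), cls_smul, LinearMap.smul_apply, wtOf_apply, hh,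
    Finsupp.single_eq_same, diagCoord_cls, nsmul_eq_mul, Matrix.diagonal_apply_eq,
    Matrix.diagonal_apply_eq]

theorem IsRootPair.cartan_bracket_F (hp : IsRootPair T u r p E F) (h : cartan T) :
    bracket T (h.1.1.1 0) (cls F hp.mem_F) = (-(r • wtOf T u)) h • cls F hp.mem_F := by
  obtain ⟨d, hd, hh, hd'⟩ := exists_diagonal h
  rw [hh, Finsupp.single_eq_same, bracket_cls hd hp.mem_F (Submodule.smul_mem _ _ hp.mem_F)
    (isEven_diagonal d) (hp.weight_F d hd hd'), cls_smul, LinearMap.neg_apply,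
    LinearMap.smul_apply, wtOf_apply, hh,
    Finsupp.single_eq_same, diagCoord_cls, nsmul_eq_mul, Matrix.diagonal_apply_eq,
    Matrix.diagonal_apply_eq]

/-- The element `a h_u + b K + c d` of the Cartan subalgebra, where `h_u` is the coroot and the last
two summands are multiples of the central element and of the derivation. -/
noncomputable def cartanElt {u : Idx T} (hu : HasWeight u) (a b c : ℂ) : cartan T :=
  ⟨⟨(Finsupp.single 0 (a • coroot u), b, c), fun q => by
    by_cases h : q = 0
    · subst h
      simp [sigma_coroot hu]
    · simp [Finsupp.single_eq_of_ne h]⟩,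
    by
      change Finsupp.single 0 (a • coroot u) 0 ∈ _
      rw [Finsupp.single_eq_same]
      exact Submodule.smul_mem _ a (coroot_mem_finCartan u),
    fun q hq => Finsupp.single_eq_of_ne hq⟩

theorem wtOf_cartanElt (v : Idx T) (hu : HasWeight u) (a b c : ℂ) :
    wtOf T v (cartanElt hu a b c) = a * diagCoord T v (coroot u) := by
  change diagCoord T v (Finsupp.single 0 (a • coroot u) 0) = _
  rw [Finsupp.single_eq_same, map_smul, smul_eq_mul]

theorem delta_cartanElt (hu : HasWeight u) (a b c : ℂ) :
    delta T (cartanElt hu a b c) = c := rfl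

theorem IsRootPair.aut_F' (hp : IsRootPair T u r p E F) (z : ℤ) :
    sigma T (cls F hp.mem_F) = T.family.root ^ (-p + 4 * z) • cls F hp.mem_F := by
  rw [root_zpow_add_four_mul, sigma_cls _ hp.aut_F]

theorem IsRootPair.mem_roots (hp : IsRootPair T u r p E F) (hu : HasWeight u) :
    r • wtOf T u + p • delta T ∈ roots T :=
  ⟨_, loop_mem_rootSpace (sigma_cls _ hp.aut_E) hp.cartan_bracket_E,
    loop_ne_zero (hp.E_ne_zero hu) _ _⟩

theorem IsRootPair.neg_mem_roots (hp : IsRootPair T u r p E F) (hu : HasWeight u) (z : ℤ) :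
    -(r • wtOf T u) + (-p + 4 * z) • delta T ∈ roots T :=
  ⟨_, loop_mem_rootSpace (hp.aut_F' z) hp.cartan_bracket_F,
    loop_ne_zero (hp.F_ne_zero hu) _ _⟩

/-- The bracket of `E ⊗ t^p` and `F ⊗ t^{-p}` is a nonzero multiple `c` of the coroot plus a central
term. It has no `d`-component, so `pδ` vanishes on it and the root takes the value `r c ≠ 0`. -/
theorem IsRootPair.exists_isTriple (hp : IsRootPair T u r p E F) (hu : HasWeight u)
    (hr : r ≠ 0) : ∃ a b : ℂ, IsTriple T (r • wtOf T u + p • delta T)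
      (loop (cls E hp.mem_E) p (sigma_cls _ hp.aut_E))
      (loop (cls F hp.mem_F) (-p) (sigma_cls _ hp.aut_F)) (cartanElt hu a b 0) := by
  obtain ⟨c, hc, h1⟩ := hp.exists_bracket_eq
  refine ⟨c, p * kappa T (cls E hp.mem_E) (cls F hp.mem_F),
    loop_mem_rootSpace _ hp.cartan_bracket_E, ?_, loop_even (cls_mem_finPart _ hp.even_E) _ _,
    loop_even (cls_mem_finPart _ hp.even_F) _ _, loop_ne_zero (hp.E_ne_zero hu) _ _,
    loop_ne_zero (hp.F_ne_zero hu) _ _, Subtype.ext ?_, ?_⟩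
  · rw [neg_add, ← neg_smul]
    exact loop_mem_rootSpace _ hp.cartan_bracket_F
  · change ambBracket T (Finsupp.single p (cls E hp.mem_E), 0, 0)
      (Finsupp.single (-p) (cls F hp.mem_F), 0, 0) = (Finsupp.single 0 (c • coroot u), _, 0)
    rw [ambBracket_single, h1, add_neg_cancel, if_pos rfl, zero_smul, add_zero]
  · rw [LinearMap.add_apply, LinearMap.smul_apply, LinearMap.smul_apply, wtOf_cartanElt,
      delta_cartanElt, diagCoord_coroot_self hu, smul_zero, add_zero, mul_one, nsmul_eq_mul]
    exact mul_ne_zero (by exact_mod_cast hr) hc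

/-- Vanishing products, rather than mere commutation, also kill the central term, which is a
multiple of `str(XY)`. -/
theorem algBracket_loop_eq_zero {X Y : SMat T} {hX : X ∈ matrixAlg T} {hY : Y ∈ matrixAlg T}
    (he : IsEven X) (h : X * Y = 0) (h' : Y * X = 0) {p q : ℤ}
    (hp : sigma T (cls X hX) = T.family.root ^ p • cls X hX)
    (hq : sigma T (cls Y hY) = T.family.root ^ q • cls Y hY) :
    algBracket T (loop _ p hp) (loop _ q hq) = 0 := by
  refine Subtype.ext ?_
  change ambBracket T (Finsupp.single p (cls X hX), 0, 0)
      (Finsupp.single q (cls Y hY), 0, 0) = 0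
  have h0 : bracket T (cls X hX) (cls Y hY) = 0 :=
    (bracket_cls hX hY (zero_mem _) he (by rw [h, h', sub_zero])).trans (map_zero _)
  rw [ambBracket_single, h0, kappa_cls, h, map_zero, mul_zero, mul_zero, ite_self, zero_smul,
    Finsupp.single_zero, add_zero]
  rfl

theorem ambForm_single (x y : FinAlg T) (a b a' b' : ℂ) :
    ambForm T (Finsupp.single 0 x, a, b) (Finsupp.single 0 y, a', b') =
      kappa T x y + a * b' + b * a' := by
  unfold ambForm
  rw [Finsupp.sum_single_index (by simp), Finsupp.sum_single_index (by simp), if_pos (add_zero 0)]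

/-- The functionals `a w_u + m δ` with `a ≠ 0` are not isotropic. -/
theorem wtForm_self_ne_zero (hs : T.scale ≠ 0) (hu : HasWeight u) {a : ℂ} (ha : a ≠ 0) (m : ℂ) :
    wtForm T (a • wtOf T u + m • delta T) (a • wtOf T u + m • delta T) ≠ 0 := by
  set α := a • wtOf T u + m • delta T with hα
  set K : ℂ := 2 * T.scale * (-1) ^ par u
  have hK : K ≠ 0 := mul_ne_zero (mul_ne_zero two_ne_zero hs)
    (pow_ne_zero _ (neg_ne_zero.mpr one_ne_zero))
  have happ : ∀ h : cartan T, α h = a * wtOf T u h + m * h.1.1.2.2 := fun h => rfl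
  have hex : ∃ t : cartan T, ∀ h : cartan T, ambForm T t.1 h.1 = α h := by
    -- `K` is the factor relating the coroot to `w_u` under `κ`, and `c` pairs with `d`; a dual
    -- vector must be exhibited because `dualVec` is defined by choice.
    refine ⟨cartanElt hu (a / K) m 0, fun h => ?_⟩
    obtain ⟨d, hd, hh, -⟩ := exists_diagonal h
    change ambForm T (Finsupp.single 0 ((a / K) • coroot u), m, 0)
      (h.1.1.1, h.1.1.2.1, h.1.1.2.2) = _
    rw [happ, wtOf_apply, hh, ambForm_single, Finsupp.single_eq_same, map_smul,
      LinearMap.smul_apply, (kappa_coroot u hd).1, smul_eq_mul]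
    change a / K * (K * _) + _ + _ = _
    field_simp
    ring
  have hspec : ∀ h : cartan T, ambForm T (dualVec T α).1 h.1 = α h :=
    Classical.epsilon_spec hex
  set t := dualVec T α
  obtain ⟨d, hd, ht, -⟩ := exists_diagonal t
  -- Pairing `t` with `c` reads off its `d`-coordinate; pairing with the coroot then determines
  -- `w_u(t) = a/K`. So the form has the value `a²/K`.
  have h1 : t.1.1.2.2 = 0 := by
    have := hspec (cartanElt hu 0 1 0)
    change ambForm T (t.1.1.1, t.1.1.2.1, t.1.1.2.2)
      (Finsupp.single 0 ((0 : ℂ) • coroot u), 1, 0) = _ at this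
    rw [happ, ht, ambForm_single, wtOf_cartanElt] at this
    change _ = _ + m * 0 at this
    simpa using this
  have h2 : K * wtOf T u t = a := by
    have := hspec (cartanElt hu 1 0 0)
    change ambForm T (t.1.1.1, t.1.1.2.1, t.1.1.2.2)
      (Finsupp.single 0 ((1 : ℂ) • coroot u), 0, 0) = _ at this
    rw [happ, ht, ambForm_single, wtOf_cartanElt, diagCoord_coroot_self hu, one_smul,
      (kappa_coroot u hd).2] at this
    change _ = _ + m * 0 at this
    rw [wtOf_apply, ht, Finsupp.single_eq_same]
    simpa using this
  have h3 : wtForm T α α = a * wtOf T u t := by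
    refine (hspec t).trans ?_
    rw [happ, h1, mul_zero, add_zero]
  rw [h3]
  refine mul_ne_zero ha fun h0 => ha ?_
  rw [← h2, h0, mul_zero]

theorem mem_realRoots (hs : T.scale ≠ 0) (hu : HasWeight u) {r m : ℤ} (hr : r ≠ 0)
    (h : r • wtOf T u + m • delta T ∈ roots T) :
    r • wtOf T u + m • delta T ∈ realRoots T := by
  refine ⟨h, ?_⟩
  have := wtForm_self_ne_zero hs hu (a := r) (by exact_mod_cast hr) m
  rwa [Int.cast_smul_eq_zsmul, Int.cast_smul_eq_zsmul] at this

theorem rootLine_subset_realRoots (hs : T.scale ≠ 0) (hu : HasWeight u) {r : ℕ} (hr : r ≠ 0) :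
    rootLine T (r • wtOf T u) ⊆ {0} ∪ realRoots T := by
  rintro _ ⟨h, m, rfl⟩
  right
  rw [← natCast_zsmul] at h ⊢
  exact mem_realRoots hs hu (by exact_mod_cast hr) h

/-! ### The elements of `Ṙ` in terms of the weights `w_u`. -/

theorem rootMult_ne_zero (u : Idx T) : rootMult T u ≠ 0 := by
  obtain ⟨F, k, l, s⟩ := T
  rcases par_eq u with h | h <;> cases F <;> simp [rootMult, h]

/-- This divisibility lets `4n w_u` be written as a multiple of the real element `rootMult T u •
wtOf T u`. -/
theorem exists_mul_rootMult (u : Idx T) : ∃ q : ℕ, 0 < q ∧ q * rootMult T u = 4 := by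
  obtain ⟨F, k, l, s⟩ := T
  rcases par_eq u with h | h <;> cases F <;>
    first
    | (refine ⟨2, by norm_num, ?_⟩; simp [rootMult, h]; done)
    | (refine ⟨4, by norm_num, ?_⟩; simp [rootMult, h])

theorem wtOf_ne_zero (hu : HasWeight u) : wtOf T u ≠ 0 := fun h => by
  have := wtOf_cartanElt u hu 1 0 0
  rw [h, diagCoord_coroot_self hu] at this
  simp at this

theorem neg_eps_eq (i : Fin T.k) : -eps T i = wtOf T (.inl (i, false)) := (wtOf_bar _).symm

theorem neg_del_eq (j : Fin T.l) : -del T j = wtOf T (.inr (.inl (j, false))) :=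
  (wtOf_bar _).symm

theorem rootMult_smul_mem_dotRoots (hu : HasWeight u) :
    rootMult T u • wtOf T u ∈ dotRoots T := by
  have heps : ∀ (i : Fin T.k) (b : Bool), ∃ i' r : Fin T.k,
      2 • wtOf T (.inl (i, b)) = eps T i' + eps T r ∨
      2 • wtOf T (.inl (i, b)) = eps T i' - eps T r ∨
      2 • wtOf T (.inl (i, b)) = -eps T i' - eps T r := fun i b => by
    refine ⟨i, i, ?_⟩
    cases b
    · exact Or.inr (Or.inr (by rw [sub_eq_add_neg, neg_eps_eq, two_smul]))
    · exact Or.inl (two_smul _ _)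
  have hdel : ∀ (j : Fin T.l) (b : Bool), ∃ j' r : Fin T.l,
      2 • wtOf T (.inr (.inl (j, b))) = del T j' + del T r ∨
      2 • wtOf T (.inr (.inl (j, b))) = del T j' - del T r ∨
      2 • wtOf T (.inr (.inl (j, b))) = -del T j' - del T r := fun j b => by
    refine ⟨j, j, ?_⟩
    cases b
    · exact Or.inr (Or.inr (by rw [sub_eq_add_neg, neg_del_eq, two_smul]))
    · exact Or.inl (two_smul _ _)
  obtain ⟨F, k, l, s⟩ := T
  rcases u with ⟨i, b⟩ | ⟨j, b⟩ | z | z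
  · cases F
    case orth =>
      rw [rootMult_eq_one rfl rfl, one_smul]
      refine Or.inl (Or.inl (Or.inl (Or.inl ⟨i, ?_⟩)))
      cases b
      · exact Or.inr (neg_eps_eq _).symm
      · exact Or.inl rfl
    case oddOdd => exact Or.inl (Or.inl (heps i b))
    all_goals exact Or.inl (Or.inl (Or.inr (heps i b)))
  · cases F
    case oddOdd => exact Or.inl (Or.inr (hdel j b))
    all_goals exact Or.inl (Or.inr (hdel j b))
  · exact hu.elim
  · exact hu.elim

/-- The link to `ζ`: its sign on this element governs nilpotency and injectivity along the whole
root line. -/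
theorem rootMult_smul_mem_dotReal (hs : T.scale ≠ 0) (hu : HasWeight u) :
    rootMult T u • wtOf T u ∈ dotReal T := by
  refine ⟨rootMult_smul_mem_dotRoots hu, fun h => ?_,
    rootLine_subset_realRoots hs hu (rootMult_ne_zero u)⟩
  rw [← Nat.cast_smul_eq_nsmul ℂ] at h
  exact (smul_ne_zero (by exact_mod_cast rootMult_ne_zero u) (wtOf_ne_zero hu)) h

/-- `γ` is zero, proportional to the weight of a basis vector, or a sum of two linearly independent
such weights. -/
def IsWeightSum (γ : Wt T) : Prop :=
  γ = 0 ∨ (∃ u : Idx T, HasWeight u ∧ (γ = wtOf T u ∨ γ = 2 • wtOf T u)) ∨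
    ∃ u v : Idx T, HasWeight u ∧ HasWeight v ∧ u ≠ v ∧ u ≠ bar v ∧ γ = wtOf T u + wtOf T v

theorem isWeightSum_wtOf {u : Idx T} (hu : HasWeight u) : IsWeightSum (wtOf T u) :=
  Or.inr (Or.inl ⟨u, hu, Or.inl rfl⟩)

theorem isWeightSum_add {u v : Idx T} (hu : HasWeight u) (hv : HasWeight v) :
    IsWeightSum (wtOf T u + wtOf T v) := by
  by_cases h : u = v
  · exact Or.inr (Or.inl ⟨u, hu, Or.inr (by rw [← h, two_smul])⟩)
  by_cases h' : u = bar v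
  · exact Or.inl (by rw [h', wtOf_bar, neg_add_cancel])
  · exact Or.inr (Or.inr ⟨u, v, hu, hv, h, h', rfl⟩)

theorem isWeightSum_of_mem_dotRoots {γ : Wt T} (hγ : γ ∈ dotRoots T) : IsWeightSum γ := by
  have he : ∀ {γ : Wt T}, (∃ i, γ = eps T i ∨ γ = -eps T i) → IsWeightSum γ := by
    rintro _ ⟨i, rfl | rfl⟩
    · exact isWeightSum_wtOf trivial
    · exact neg_eps_eq i ▸ isWeightSum_wtOf trivial
  have hd : ∀ {γ : Wt T}, (∃ j, γ = del T j ∨ γ = -del T j) → IsWeightSum γ := by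
    rintro _ ⟨j, rfl | rfl⟩
    · exact isWeightSum_wtOf trivial
    · exact neg_del_eq j ▸ isWeightSum_wtOf trivial
  have hee : ∀ {γ : Wt T}, (∃ i r, γ = eps T i + eps T r ∨ γ = eps T i - eps T r ∨
      γ = -eps T i - eps T r) → IsWeightSum γ := by
    rintro _ ⟨i, r, rfl | rfl | rfl⟩ <;>
      try simp only [sub_eq_add_neg, neg_eps_eq]
    all_goals exact isWeightSum_add (by exact trivial) (by exact trivial)
  have hdd : ∀ {γ : Wt T}, (∃ j s, γ = del T j + del T s ∨ γ = del T j - del T s ∨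
      γ = -del T j - del T s) → IsWeightSum γ := by
    rintro _ ⟨i, r, rfl | rfl | rfl⟩ <;>
      try simp only [sub_eq_add_neg, neg_del_eq]
    all_goals exact isWeightSum_add (by exact trivial) (by exact trivial)
  have hed : ∀ {γ : Wt T}, (∃ i j, γ = eps T i + del T j ∨ γ = eps T i - del T j ∨
      γ = -eps T i + del T j ∨ γ = -eps T i - del T j) → IsWeightSum γ := by
    rintro _ ⟨i, r, rfl | rfl | rfl | rfl⟩ <;>
      try simp only [sub_eq_add_neg, neg_del_eq, neg_eps_eq]
    all_goals exact isWeightSum_add (by exact trivial) (by exact trivial)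
  obtain ⟨F, k, l, s⟩ := T
  cases F
  case oddOdd =>
    rcases hγ with (h | h) | h
    exacts [hee h, hdd h, hed h]
  case orth =>
    rcases hγ with (((h | h) | ⟨i, r, -, h⟩) | h) | h
    exacts [he h, hd h, hee ⟨i, r, h⟩, hdd h, hed h]
  all_goals
    rcases hγ with (((h | h) | h) | h) | h
    exacts [he h, hd h, hee h, hdd h, hed h]

end algebra

/-! ### From directions in `Ṙ` to roots acting on the module. -/

section modules

variable {T : AffineType} {M : Type*} [AddCommGroup M] [Module ℂ M]
  {ρ : Alg T →ₗ[ℂ] Module.End ℂ M}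

/-- The multiple of the weight of the basis vector with index `u` that is real in `Ṙ`. -/
noncomputable def realWt {u : Idx T} (hu : HasWeight u) : Submodule.span ℝ (dotRoots T) :=
  ⟨rootMult T u • wtOf T u, Submodule.subset_span (rootMult_smul_mem_dotRoots hu)⟩

theorem IsRootPair.mem_nilRoots {u : Idx T} {p : ℤ} {E F : SMat T}
    (hp : IsRootPair T u (rootMult T u) p E F) (hu : HasWeight u)
    (hn : rootLine T (rootMult T u • wtOf T u) ⊆ nilRoots ρ) :
    rootMult T u • wtOf T u + p • delta T ∈ nilRoots ρ :=
  hn ⟨hp.mem_roots hu, p, rfl⟩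

theorem IsRootPair.neg_mem_injRoots {u : Idx T} {p : ℤ} {E F : SMat T}
    (hp : IsRootPair T u (rootMult T u) p E F) (hu : HasWeight u)
    (hi : rootLine T (-(rootMult T u • wtOf T u)) ⊆ injRoots ρ) (z : ℤ) :
    -(rootMult T u • wtOf T u + p • delta T) + (4 * z) • delta T ∈ injRoots ρ := by
  have h : -(rootMult T u • wtOf T u + p • delta T) + (4 * z) • delta T =
      -(rootMult T u • wtOf T u) + (-p + 4 * z) • delta T := by
    rw [add_smul, neg_smul]; abel
  rw [h]
  exact hi ⟨hp.neg_mem_roots hu z, _, rfl⟩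

theorem IsRootPair.mem_realRoots {u : Idx T} {p : ℤ} {E F : SMat T}
    (hp : IsRootPair T u (rootMult T u) p E F) (hs : T.scale ≠ 0) (hu : HasWeight u) :
    rootMult T u • wtOf T u + p • delta T ∈ realRoots T ∧
      -(rootMult T u • wtOf T u + p • delta T) ∈ realRoots T := by
  have h1 := hp.mem_roots hu
  have h2 := hp.neg_mem_roots hu 0
  have h0 : (rootMult T u : ℤ) ≠ 0 := by exact_mod_cast rootMult_ne_zero u
  have h3 : -(rootMult T u • wtOf T u + p • delta T) =
      (-(rootMult T u : ℤ)) • wtOf T u + (-p) • delta T := by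
    rw [neg_smul, neg_smul, natCast_zsmul]; abel
  rw [← natCast_zsmul] at h1 h2 ⊢
  rw [← natCast_zsmul] at h3
  refine ⟨TwistedAffine.mem_realRoots hs hu h0 h1, ?_⟩
  rw [h3]
  refine TwistedAffine.mem_realRoots hs hu (neg_ne_zero.mpr h0) ?_
  rwa [mul_zero, add_zero, ← neg_smul] at h2

/-- The case of a direction with two independent components, the first of which is nilpotent with
injective opposite. -/
theorem unbounded_of_two_weights (hs : T.scale ≠ 0) (hρ : IsRep ρ) (hfin : IsFiniteWeight ρ)
    (hsh : HasShadow ρ) {u v : Idx T} (hu : HasWeight u) (hv : HasWeight v) (huv : u ≠ v)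
    (huv' : u ≠ bar v) (hn : rootLine T (rootMult T u • wtOf T u) ⊆ nilRoots ρ)
    (hi : rootLine T (-(rootMult T u • wtOf T u)) ⊆ injRoots ρ) {lam : Wt T} {k : ℕ → ℤ}
    (hk : ∀ n : ℕ, 0 < n →
      lam + (4 * n) • (wtOf T u + wtOf T v) + k n • delta T ∈ support ρ) (N : ℕ) :
    ∃ μ : Wt T, N < Module.finrank ℂ (weightSpace ρ μ) := by
  obtain ⟨p, E, F, p', E', F', hp, hp', hEE, hEE'⟩ := exists_isRootPair_commuting hu hv huv'
  obtain ⟨a, b, t⟩ := hp.exists_isTriple hu (rootMult_ne_zero u)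
  obtain ⟨a', b', t'⟩ := hp'.exists_isTriple hv (rootMult_ne_zero v)
  obtain ⟨q, hq, hqu⟩ := exists_mul_rootMult u
  obtain ⟨q', hq', hqv⟩ := exists_mul_rootMult v
  have hreal := hp'.mem_realRoots hs hv
  have hvu : v ≠ bar u := fun h => huv' (by rw [h, bar_bar])
  refine unbounded_of_roots hρ hfin hsh t t'
    (algBracket_loop_eq_zero hp.even_E hEE hEE' _ _) ?_ ?_ (hp.mem_nilRoots hu hn)
    (hp.neg_mem_injRoots hu hi) hreal.1 hreal.2 hq hq' (lam := lam)
    -- The roots are `r w_u + pδ` and `r' w_v + p'δ`, so passing from weights to roots changes the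
    -- coefficient of `δ` by `nqp + nq'p'`.
    (k := fun n => k n - n * q * p - n * q' * p') (fun n hn => ?_) N
  · simp [wtOf_cartanElt, delta_cartanElt, diagCoord_coroot_of_ne huv.symm hvu]
  · simp [wtOf_cartanElt, delta_cartanElt, diagCoord_coroot_of_ne huv huv']
  · convert hk n hn using 1
    have e1 : (4 * n) • wtOf T u = (n * q) • (rootMult T u • wtOf T u) := by
      rw [smul_smul, mul_assoc, hqu, mul_comm]
    have e2 : (4 * n) • wtOf T v = (n * q') • (rootMult T v • wtOf T v) := by
      rw [smul_smul, mul_assoc, hqv, mul_comm]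
    rw [smul_add (4 * n), e1, e2]
    module

theorem false_of_one_weight (hsh : HasShadow ρ) {u : Idx T} (hu : HasWeight u)
    (hn : rootLine T (rootMult T u • wtOf T u) ⊆ nilRoots ρ)
    (hi : rootLine T (-(rootMult T u • wtOf T u)) ⊆ injRoots ρ) {c : ℕ} (hc : 0 < c)
    {lam : Wt T} {k : ℕ → ℤ}
    (hk : ∀ n : ℕ, 0 < n → lam + (4 * n) • c • wtOf T u + k n • delta T ∈ support ρ) :
    False := by
  obtain ⟨p, E, F, hp⟩ := exists_isRootPair hu
  obtain ⟨q, hq, hqu⟩ := exists_mul_rootMult u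
  refine false_of_root_multiples hsh (hp.mem_nilRoots hu hn) (hp.neg_mem_injRoots hu hi)
    (Nat.mul_pos hc hq) (lam := lam) (k := fun n => k n - n * (c * q) * p) (fun n hn => ?_)
  convert hk n hn using 1
  have e1 : (4 * n) • c • wtOf T u = (n * (c * q)) • (rootMult T u • wtOf T u) := by
    rw [smul_smul, smul_smul, ← hqu]
    ring_nf
  rw [e1]
  module

end modules

end TwistedAffine

/-! ### The theorem. -/

open TwistedAffine in
theorem corollary3p5 (T : AffineType) (hT : T.Admissible)
    {M : Type*} [AddCommGroup M] [Module ℂ M] (ρ : Alg T →ₗ[ℂ] Module.End ℂ M)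
    (hρ : IsRep ρ) (hfin : IsFiniteWeight ρ) (hshadow : HasShadow ρ)
    (ζ : Submodule.span ℝ (dotRoots T) →ₗ[ℝ] ℝ)
    (hζ : ∀ γ : Submodule.span ℝ (dotRoots T), (γ : Wt T) ∈ dotReal T →
      (0 < ζ γ ↔ rootLine T γ ⊆ nilRoots ρ ∧ rootLine T (-γ) ⊆ injRoots ρ))
    (ε : Submodule.span ℝ (dotRoots T)) (hε : (ε : Wt T) ∈ dotNonsing T) (hζε : 0 < ζ ε)
    (lam : Wt T) (hlam : lam ∈ support ρ) (k : ℕ → ℤ)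
    (hk : ∀ n : ℕ, 0 < n → lam + (4 * n) • (ε : Wt T) + k n • delta T ∈ support ρ) :
    ∀ N : ℕ, ∃ μ : Wt T, N < Module.finrank ℂ (weightSpace ρ μ) := by
  intro N
  have hreal : ∀ {u : Idx T} (hu : HasWeight u), 0 < ζ (realWt hu) →
      rootLine T (rootMult T u • wtOf T u) ⊆ nilRoots ρ ∧
        rootLine T (-(rootMult T u • wtOf T u)) ⊆ injRoots ρ := fun hu h =>
    (hζ (realWt hu) (rootMult_smul_mem_dotReal hT.2.1 hu)).mp h
  rcases isWeightSum_of_mem_dotRoots hε.1 with h0 | ⟨u, hu, h⟩ | ⟨u, v, hu, hv, huv, huv', h⟩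
  · exact absurd h0 hε.2.1
  · obtain ⟨c, hc, hεc⟩ : ∃ c : ℕ, 0 < c ∧ (ε : Wt T) = c • wtOf T u := by
      rcases h with h | h
      · exact ⟨1, one_pos, by rw [h, one_smul]⟩
      · exact ⟨2, two_pos, h⟩
    -- Both sides are positive multiples of `w_u`, so `ζ` has the same sign on `ε` and on the real
    -- element.
    have h1 : rootMult T u • ε = c • realWt hu := Subtype.ext (by
      change rootMult T u • (ε : Wt T) = c • rootMult T u • wtOf T u
      rw [hεc, smul_comm])
    have h2 := congrArg ζ h1
    rw [map_nsmul, map_nsmul, nsmul_eq_mul, nsmul_eq_mul] at h2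
    have h3 : 0 < ζ (realWt hu) := by
      refine pos_of_mul_pos_right (a := (c : ℝ)) (h2 ▸ mul_pos ?_ hζε) (Nat.cast_nonneg c)
      exact_mod_cast Nat.pos_of_ne_zero (rootMult_ne_zero u)
    rw [hεc] at hk
    exact (false_of_one_weight hshadow hu (hreal hu h3).1 (hreal hu h3).2 hc hk).elim
  · obtain ⟨q, hq, hqu⟩ := exists_mul_rootMult u
    obtain ⟨q', hq', hqv⟩ := exists_mul_rootMult v
    have h1 : 4 • ε = q • realWt hu + q' • realWt hv := Subtype.ext (by
      change 4 • (ε : Wt T) = q • rootMult T u • wtOf T u + q' • rootMult T v • wtOf T v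
      rw [h, smul_smul, smul_smul, hqu, hqv, smul_add])
    have h2 := congrArg ζ h1
    rw [map_add, map_nsmul, map_nsmul, map_nsmul] at h2
    simp only [nsmul_eq_mul] at h2
    -- `4ε` is a combination of the two real elements with positive coefficients, so `ζ` cannot be
    -- nonpositive on both. The hypotheses are symmetric in `u` and `v`, so either can play the role
    -- of `α`.
    have h3 : 0 < ζ (realWt hu) ∨ 0 < ζ (realWt hv) := by
      by_contra! hcon
      have h4 := mul_nonpos_of_nonneg_of_nonpos (Nat.cast_nonneg (α := ℝ) q) hcon.1
      have h5 := mul_nonpos_of_nonneg_of_nonpos (Nat.cast_nonneg (α := ℝ) q') hcon.2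
      push_cast at h2
      linarith
    rcases h3 with h3 | h3
    · rw [h] at hk
      exact unbounded_of_two_weights hT.2.1 hρ hfin hshadow hu hv huv huv' (hreal hu h3).1
        (hreal hu h3).2 hk N
    · rw [h, add_comm (wtOf T u)] at hk
      exact unbounded_of_two_weights hT.2.1 hρ hfin hshadow hv hu huv.symm
        (fun h => huv' (by rw [h, bar_bar])) (hreal hv h3).1 (hreal hv h3).2 hk N
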